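/- Let $\Lambda$ be a nonzero measure on $(0,\infty)$ with finite total mass $b=\Lambda((0,\infty))$, and let $m=\int_{(0,\infty)} z\,\Lambda(dz)$. Assume that either $m<1$ and $\int_{[1,\infty)} z\log z\,\Lambda(dz)<\infty$, or $m=1$ and $\int_{(0,\infty)} z^2\,\Lambda(dz)<\infty$. Let $\mathbf P$ be the law of the splitting tree $\mathbb T$ with lifespan measure $\Lambda$: there is one ancestor $\emptyset$, born at time $0$; individuals behave independently, have i.i.d. lifetimes with law $\Lambda/b$, and give birth, singly, at the points of a Poisson process with intensity $b$ during their life. Individuals are labelled by finite words $u$ of positive integers, the daughters of $u$ being $u1,u2,\dots$, from the youngest (last born) to the oldest, and $\mathbb T$ is the set of the pairs $(u,s)$ such that the individual $u$ is alive at time $s$, i.e. $\alpha(u)<s\le\omega(u)$ where $\alpha(u)$ and $\omega(u)$ are its times of birth and death, together with the root $(\emptyset,0)$. Let $\mathcal Z_n$ be the number of individuals of generation $n$ (words of length $n$), and $\mathbf P^n=\mathbf P(\,\cdot\mid\mathcal Z_n\neq0)$. On $\{\mathcal Z_n\ne0\}$ let $\mathbb B^n\subset\mathbb T$ be the set of points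 of the first lineage that reaches generation $n$: starting from $\emptyset$, one goes at each step to the youngest daughter that has a descendant at generation $n$ (or belongs to this generation). Random sets of points $(u,s)$, or pairs of such sets, are said to converge for finite truncations if, for every $\sigma>0$, the probability of every event that is measurable with respect to their truncations $\{(u,s): s\le\sigma\}$ converges. Then, as $n\to\infty$: 1. The law of $\mathbb B^n$ under $\mathbf P^n$, modulo labelling (each label being replaced by its generation), converges for finite truncations to the law of an infinite spine characterized by an i.i.d. sequence $(A_k,R_k)_{k\ge0}$ with $(A_0,R_0)\overset{(d)}=(UD,(1-U)D)$, where $U$ is uniform on $(0,1)$ and independent of $D$, and $\mathbf P(D\in dz)=z\Lambda(dz)/m$: the $k$-th individual of the spine is born at time $A_0+\dots+A_{k-1}$, gives birth to the next one at age $A_k$, and has lifetime $A_k+R_k$. 2. The law of $\mathbb T$ under $\mathbf P^n$, jointly with $\mathbb B^n$, converges for finite truncations to the law of the infinite tree, jointly with its spine $\mathbb B$, which is obtained from the spine of part 1 by grafting, at the points $x_i$ of a Poisson measure with intensity $b$ on the spine, i.i.d. trees with common law $\mathbf P$ which are independent of the spine and of the $x_i$ (daughters of each spine individual being labelled from the youngest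 to the oldest). 3. Almost surely, the limiting tree has a unique infinite branch, and this branch is $\mathbb B$. -/

import Mathlib

open MeasureTheory ProbabilityTheory Set Filter Topology
open scoped ENNReal NNReal

namespace SplittingTree

/-! ### Chronological trees -/

/-- Labels of individuals: finite words of positive integers. The empty word is the ancestor, and
`u ++ [j]` is the `j`-th daughter of `u`. -/
abbrev Label : Type := List ℕ+

/-- A (chronological) tree is given by its set of points `(u, s)`: the individual `u` is alive at
time `s`. The σ-field on this type is the one of Mathlib on `Set α`, generated by the
events `{T | (u, s) ∈ T}`. -/
abbrev Tree : Type := Set (Label × ℝ)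

/-- The discrete tree of individuals of `T`. -/
def individuals (T : Tree) : Set Label := Prod.fst '' T

/-- Birth level of the individual `u`. -/
noncomputable def birthLevel (T : Tree) (u : Label) : ℝ := sInf {s | (u, s) ∈ T}

/-- `u` has an extant descendant at generation `n` (the generation of `v` is its length). -/
def HasDescendanceAt (T : Tree) (n : ℕ) (u : Label) : Prop :=
  ∃ v ∈ individuals T, v.length = n ∧ u <+: v

/-- The number of individuals belonging to generation `n`. -/
noncomputable def genSize (n : ℕ) (T : Tree) : ℕ∞ := {v ∈ individuals T | v.length = n}.encard

/-- `u` is the end of the first lineage of `T` that reaches generation `n`: `u` has length `n`, is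
an individual of `T`, and each ancestor of `u` of generation `1, …, n` is the youngest among those
of its sisters (itself included) that have a descendant at generation `n`. -/
def IsFirstLineage (T : Tree) (n : ℕ) (u : Label) : Prop :=
  u ∈ individuals T ∧ u.length = n ∧
    ∀ k < n, ∀ j : ℕ+, HasDescendanceAt T n (u.take k ++ [j]) →
      birthLevel T (u.take k ++ [j]) ≤ birthLevel T (u.take (k + 1))

/-- The distinguished lineage: all the points of `T` that belong to
an individual of the first lineage reaching generation `n`. -/
def firstLineage (n : ℕ) (T : Tree) : Tree :=
  {x ∈ T | ∃ u, IsFirstLineage T n u ∧ x.1 <+: u}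

/-- Truncation at level `σ` of a set of points (whose second coordinate is time). -/
def trunc {α : Type} (σ : ℝ) (T : Set (α × ℝ)) : Set (α × ℝ) := {x ∈ T | x.2 ≤ σ}

/-- A set of points modulo labelling: only the generation of each individual is kept. -/
def forgetLabels (T : Tree) : Set (ℕ × ℝ) := (fun x => (x.1.length, x.2)) '' T

/-- The points that are added when the tree `T` is grafted as an individual `u` born
at time `a`. -/
def graftAt (u : Label) (a : ℝ) (T : Tree) : Tree :=
  {x | ∃ v τ, (v, τ) ∈ T ∧ 0 < τ ∧ x = (u ++ v, a + τ)}

/-- The prefix of length `n` of an infinite word. -/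
def wordPrefix (v : ℕ → ℕ+) (n : ℕ) : Label := (List.range n).map v

/-- The infinite word `v` is an infinite branch of `T`. -/
def IsInfiniteBranch (T : Tree) (v : ℕ → ℕ+) : Prop := ∀ n, wordPrefix v n ∈ individuals T

/-- Label, among the daughters of one mother, of the daughter born when the mother has age `a`, if
`F` is the set of ages of the mother at all births: the youngest daughter has label `1`. -/
noncomputable def daughterLabel (F : Finset ℝ) (a : ℝ) : ℕ+ := Nat.succPNat (F.filter (fun f => a < f)).card

/-! ### Poisson points -/

/-- Code of a finite configuration of points of an interval: `c.1` is the number of points,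
and `c.2 i`, `i < c.1`, are their positions as fractions of the length of the interval. -/
abbrev Config : Type := ℕ × (ℕ → ℝ)

/-- The points, in the interval `(0, z)`, of the configuration `c`. -/
noncomputable def points (z : ℝ) (c : Config) : Finset ℝ :=
  (Finset.range c.1).image fun i => z * c.2 i

/-- The uniform law on `(0, 1)`. -/
noncomputable def unif : Measure ℝ := volume.restrict (Ioo 0 1)

instance : IsProbabilityMeasure unif := ⟨by simp [unif]⟩

lemma measurable_poissonMeasure : Measurable poissonMeasure := by
  refine Measure.measurable_of_measurable_coe _ fun s _ => ?_
  simp only [poissonMeasure, Measure.sum_apply_of_countable, Measure.smul_apply, smul_eq_mul]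
  fun_prop

/-- The law of a Poisson measure with intensity `b` on `(0, z)`: a Poisson number, with
parameter `b * z`, of i.i.d. uniform points. -/
noncomputable def poissonKernel (b : ℝ≥0) : Kernel ℝ Config :=
  Kernel.prod
    ⟨fun z => poissonMeasure (b * z.toNNReal), measurable_poissonMeasure.comp (by fun_prop)⟩
    (Kernel.const ℝ (Measure.infinitePi fun _ : ℕ => unif))

instance (b : ℝ≥0) : IsMarkovKernel (poissonKernel b) := by
  have : IsMarkovKernel (⟨fun z => poissonMeasure (b * z.toNNReal),
      measurable_poissonMeasure.comp (by fun_prop)⟩ : Kernel ℝ ℕ) :=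
    ⟨fun z => inferInstanceAs (IsProbabilityMeasure (poissonMeasure (b * z.toNNReal)))⟩
  unfold poissonKernel
  infer_instance

/-! ### Splitting trees -/

/-- What happens to one individual: her lifetime, and (the code of) her ages at childbirth. -/
abbrev Life : Type := ℝ × Config

/-- Ages at which an individual gives birth. -/
noncomputable def birthAges (ℓ : Life) : Finset ℝ := points ℓ.1 ℓ.2

/-- `InTree d u s` means that `(u, s)` is a point of the tree in which
the individual `u` has the life `d u`. The ancestor lives on `[0, ζ]`, and the tree that
descends from a daughter of the ancestor is shifted by the age of the ancestor at her birth. -/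
def InTree (d : Label → Life) : Label → ℝ → Prop
  | [], s => 0 ≤ s ∧ s ≤ (d []).1
  | j :: w, s => ∃ a ∈ birthAges (d []), daughterLabel (birthAges (d [])) a = j ∧
      0 < s - a ∧ InTree (fun v => d (j :: v)) w (s - a)

/-- The chronological tree in which the individual `u` has the life `d u`. -/
def tree (d : Label → Life) : Tree := {x | InTree d x.1 x.2}

/-- The birth rate `b`, i.e. the total mass of the lifespan measure. -/
noncomputable def birthRate (Λ : Measure ℝ) : ℝ≥0 := (Λ univ).toNNReal

/-- The mean `m = ∫ z Λ(dz)`. -/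
noncomputable def meanOffspring (Λ : Measure ℝ) : ℝ≥0∞ := ∫⁻ z, ENNReal.ofReal z ∂Λ

/-- The law of the life of one individual: the lifetime has law `Λ / b` and, given the
lifetime `z`, births occur at the points of a Poisson process with intensity `b` on `(0, z)`. -/
noncomputable def lifeLaw (Λ : Measure ℝ) : Measure Life :=
  ((Λ univ)⁻¹ • Λ) ⊗ₘ poissonKernel (birthRate Λ)

/-- The splitting tree with lifespan measure `Λ` is `tree d` when `d` has this law: the lives of
the individuals are i.i.d. -/
noncomputable def splittingLaw (Λ : Measure ℝ) : Measure (Label → Life) :=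
  Measure.infinitePi fun _ => lifeLaw Λ

/-- The law of the lives of the individuals of the splitting tree,
conditional on having individuals at generation `n`. -/
noncomputable def condLaw (Λ : Measure ℝ) (n : ℕ) : Measure (Label → Life) :=
  (splittingLaw Λ)[|{d | genSize n (tree d) ≠ 0}]

/-! ### The limiting spine -/

/-- The size-biased lifetime law `z Λ(dz) / m`. -/
noncomputable def sizeBiased (Λ : Measure ℝ) : Measure ℝ :=
  (meanOffspring Λ)⁻¹ • Λ.withDensity ENNReal.ofReal

/-- The law of `(U D, (1 - U) D)` with `U` uniform on `(0, 1)` independent of the size-biased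
variable `D`. -/
noncomputable def stepLaw (Λ : Measure ℝ) : Measure (ℝ × ℝ) :=
  (unif.prod (sizeBiased Λ)).map fun p => (p.1 * p.2, (1 - p.1) * p.2)

/-- Birth level of the `k`-th individual of a spine, if the `i`-th one gives birth to
the next one at age `(AR i).1`. -/
noncomputable def spineBirth (AR : ℕ → ℝ × ℝ) (k : ℕ) : ℝ := ∑ i ∈ Finset.range k, (AR i).1

/-- `s` is a time at which the `k`-th individual of the spine is alive, where `(AR k).1` is
her age at the birth of the next individual of the spine and `(AR k).2` is her residual lifetime
at this birth. As in every tree, the root `(∅, 0)` is included. -/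
def SpineAlive (AR : ℕ → ℝ × ℝ) (k : ℕ) (s : ℝ) : Prop :=
  (k = 0 ∧ s = 0) ∨
    (spineBirth AR k < s ∧ s ≤ spineBirth AR k + (AR k).1 + (AR k).2)

/-- The spine, modulo labelling, that is characterized by the sequence `AR`. -/
def unlabelledSpine (AR : ℕ → ℝ × ℝ) : Set (ℕ × ℝ) := {x | SpineAlive AR x.1 x.2}

/-! ### The limiting tree -/

/-- Data of the limiting tree: for the `k`-th individual of the spine, the pair `(A_k, R_k)` and
the configuration of the grafting points on this individual; and for all `k` and `i`, the
lives of the individuals of the tree that is grafted at the `i`-th of these points. -/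
abbrev LimitData : Type := (ℕ → (ℝ × ℝ) × Config) × (ℕ → ℕ → Label → Life)

/-- The law of the data of the limiting tree. The pairs `(A_k, R_k)` are i.i.d., the grafting
points form a Poisson measure with intensity `b` on the spine, and the grafted trees are i.i.d.
splitting trees, independent of the spine and the grafting points. -/
noncomputable def limitLaw (Λ : Measure ℝ) : Measure LimitData :=
  (Measure.infinitePi fun _ : ℕ =>
      stepLaw Λ ⊗ₘ (poissonKernel (birthRate Λ)).comap (fun p => p.1 + p.2) (by fun_prop)).prod
    (Measure.infinitePi fun _ : ℕ => Measure.infinitePi fun _ : ℕ => splittingLaw Λ)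

/-- The pairs `(A_k, R_k)`. -/
def spineSteps (ξ : LimitData) : ℕ → ℝ × ℝ := fun k => (ξ.1 k).1

/-- Age of the `k`-th individual of the spine at the `i`-th grafting point on her. -/
noncomputable def graftAge (ξ : LimitData) (k i : ℕ) : ℝ :=
  ((spineSteps ξ k).1 + (spineSteps ξ k).2) * (ξ.1 k).2.2 i

/-- Ages of the `k`-th individual of the spine at all her births: at the
grafting points, and at the birth of the next individual of the spine. -/
noncomputable def spineBirthAges (ξ : LimitData) (k : ℕ) : Finset ℝ :=
  insert (spineSteps ξ k).1
    (points ((spineSteps ξ k).1 + (spineSteps ξ k).2) (ξ.1 k).2)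

/-- Label of the `k`-th individual of the spine. -/
noncomputable def spineLabel (ξ : LimitData) : ℕ → Label
  | 0 => []
  | k + 1 => spineLabel ξ k ++ [daughterLabel (spineBirthAges ξ k) (spineSteps ξ k).1]

/-- The infinite spine. -/
def limitSpine (ξ : LimitData) : Tree :=
  {x | ∃ k, x.1 = spineLabel ξ k ∧ SpineAlive (spineSteps ξ) k x.2}

/-- The infinite tree: the spine, with a splitting tree grafted at each grafting point. -/
noncomputable def limitTree (ξ : LimitData) : Tree :=
  limitSpine ξ ∪ ⋃ (k : ℕ) (i : ℕ) (_ : i < (ξ.1 k).2.1),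
    graftAt (spineLabel ξ k ++ [daughterLabel (spineBirthAges ξ k) (graftAge ξ k i)])
      (spineBirth (spineSteps ξ) k + graftAge ξ k i) (tree (ξ.2 k i))

end SplittingTree

/-! The proof rests on an exact recursion for the conditioned tree. Summing a functional over the
daughters of the ancestor biases the lifetime by its length and the Poisson number of births by its
size. The marked birth is then uniform on the life, the other births are again Poisson with
intensity `b`, and all subtrees are independent splitting trees (`many_to_one`). If generation `n +
1` is reached, exactly one daughter starts the first lineage: her progeny lasts `n` more generations
and that of no younger sister does (`NoRight n`). Inserting this indicator gives
`measure_reach_succ` and, after division, `conditionedLaw_succ`: the tree conditioned on reaching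
generation `n + 1` is one spine individual, conditioned on `NoRight n`, that carries at age `A` a
tree conditioned on reaching generation `n`.

The limiting tree obeys the same recursion without conditioning (`limitTreeLaw_eq`), so it must be
shown that the probability `r n` of `NoRight n` tends to 1. Let `p n` be the probability of reaching
generation `n`. Then `p (n + 1) = m * r n * p n`, and `r n + κ * p n ≤ 1`, where `κ > 0` is the
probability of `rightGraft`. As `m ≤ 1`, this gives `p (n + 1) + κ * p n ^ 2 ≤ p n`, hence `p n →
0`. The finitely many trees grafted on one individual thus die out almost surely, and `r n → 1`.

The two recursions are compared through the largest discrepancy `x n σ` on events of the window `(0,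
σ]` (`excess`). After one step only a window of length `σ - A` remains, so with `c n = (r n)⁻¹` one
gets `x (n + 1) σ ≤ (c n - 1) + c n * (P(A < ε) * x n σ + x n (σ - ε))` (`excess_succ_le`). For `ε`
with `P(A < ε) < 1` this is an asymptotic contraction, and induction over the windows `k * ε` gives
`x n σ → 0`: convergence holds in total variation on each window.

Part 1 is a projection of part 2. For part 3, an infinite branch that left the spine would stay in
one of finitely many grafted trees, all of them extinct.

Since `graftAt` discards the nonpositive times of the grafted tree, the recursions are written for
positive times only, and the root is put back at the end. -/

namespace SplittingTree

/-! ### Product measures -/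

section Product

variable {ι κ X : Type*} [MeasurableSpace X]

lemma measurePreserving_option_elim (μ : Measure X) [IsProbabilityMeasure μ] :
    MeasurePreserving (fun (p : X × (κ → X)) (o : Option κ) => o.elim p.1 p.2)
      (μ.prod (Measure.infinitePi fun _ : κ => μ)) (Measure.infinitePi fun _ : Option κ => μ) := by
  have hm : Measurable (fun (p : X × (κ → X)) (o : Option κ) => o.elim p.1 p.2) := by
    refine measurable_pi_lambda _ fun o => ?_
    cases o
    · exact measurable_fst
    · exact (measurable_pi_apply _).comp measurable_snd
  refine ⟨hm, Measure.eq_infinitePi _ fun s t ht => ?_⟩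
  classical
  rw [Measure.map_apply hm (.pi s.countable_toSet fun _ _ => ht _)]
  have h : (fun (p : X × (κ → X)) (o : Option κ) => o.elim p.1 p.2) ⁻¹' (s : Set (Option κ)).pi t =
      (if none ∈ s then t none else univ) ×ˢ
        (Finset.eraseNone s : Set κ).pi (fun k => t (some k)) := by
    ext p
    by_cases h0 : none ∈ s
    · simp [h0, Set.mem_pi, Option.forall]
    · simp only [mem_preimage, Set.mem_pi, Option.forall, h0, if_false, mem_prod]
      simp [h0]
  rw [h, Measure.prod_prod, Measure.infinitePi_pi _ fun _ _ => ht _]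
  by_cases h0 : none ∈ s
  · rw [if_pos h0]
    conv_rhs => rw [← Finset.insert_erase h0, Finset.prod_insert (Finset.notMem_erase _ _)]
    congr 1
    rw [← Finset.map_some_eraseNone, Finset.prod_map]
    rfl
  · rw [if_neg h0, measure_univ, one_mul]
    conv_rhs => rw [← Finset.erase_eq_of_notMem h0, ← Finset.map_some_eraseNone, Finset.prod_map]
    rfl

/-- Among i.i.d. coordinates, a given one is independent of the family of any others. -/
lemma measurePreserving_eval_comp (μ : Measure X) [IsProbabilityMeasure μ] {i : ι} {g : κ → ι}
    (hg : Function.Injective g) (hi : ∀ k, g k ≠ i) :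
    MeasurePreserving (fun ω : ι → X => (ω i, fun k => ω (g k)))
      (Measure.infinitePi fun _ : ι => μ) (μ.prod (Measure.infinitePi fun _ : κ => μ)) := by
  have hm : Measurable (fun q : Option κ → X => (q none, fun k => q (some k))) := by fun_prop
  have hinj : Function.Injective (fun o : Option κ => o.elim i g) := by
    rintro (_ | a) (_ | b) h
    · rfl
    · exact absurd h.symm (hi b)
    · exact absurd h (hi a)
    · exact congrArg some (hg h)
  have h1 := Measure.map_infinitePi_infinitePi_of_inj (P := fun _ : ι => μ) hinj
  have h2 := (measurePreserving_option_elim (κ := κ) μ).map_eq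
  refine ⟨by fun_prop, ?_⟩
  have h3 := congrArg (Measure.map fun q : Option κ → X => (q none, fun k => q (some k)))
    (h1.trans h2.symm)
  rw [Measure.map_map hm (by fun_prop), Measure.map_map hm
    (measurePreserving_option_elim (κ := κ) μ).measurable] at h3
  refine h3.trans ?_
  conv_rhs => rw [← Measure.map_id (μ := μ.prod (Measure.infinitePi fun _ : κ => μ))]
  rfl

lemma measurePreserving_head_tail (μ : Measure X) [IsProbabilityMeasure μ] :
    MeasurePreserving (fun ω : ℕ → X => (ω 0, fun k => ω (k + 1)))
      (Measure.infinitePi fun _ : ℕ => μ) (μ.prod (Measure.infinitePi fun _ : ℕ => μ)) :=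
  measurePreserving_eval_comp μ (add_left_injective 1) fun _ => Nat.succ_ne_zero _

end Product

/-! ### The branching property at the ancestor -/

section Laws

variable (Λ : Measure ℝ) [IsFiniteMeasure Λ] [NeZero Λ]

instance : IsProbabilityMeasure ((Λ univ)⁻¹ • Λ) :=
  ⟨by simp⟩

instance : IsProbabilityMeasure (lifeLaw Λ) := by unfold lifeLaw; infer_instance

instance : IsProbabilityMeasure (splittingLaw Λ) := by unfold splittingLaw; infer_instance

/-- The life of the ancestor is independent of the i.i.d. families of lives of the descendants of
her daughters. -/
lemma measurePreserving_root_daughters :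
    MeasurePreserving (fun d : Label → Life => (d [], fun (j : ℕ+) (v : Label) => d (j :: v)))
      (splittingLaw Λ) ((lifeLaw Λ).prod (Measure.infinitePi fun _ : ℕ+ => splittingLaw Λ)) := by
  have h1 : MeasurePreserving
      (fun d : Label → Life => (d [], fun p : ℕ+ × Label => d (p.1 :: p.2)))
      (splittingLaw Λ) ((lifeLaw Λ).prod (Measure.infinitePi fun _ : ℕ+ × Label => lifeLaw Λ)) :=
    measurePreserving_eval_comp (lifeLaw Λ) (g := fun p : ℕ+ × Label => p.1 :: p.2)
      (fun p q h => by simp at h; exact Prod.ext h.1 h.2) fun p => by simp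
  have h2 : MeasurePreserving (MeasurableEquiv.curry ℕ+ Label Life)
      (Measure.infinitePi fun _ : ℕ+ × Label => lifeLaw Λ)
      (Measure.infinitePi fun _ : ℕ+ => splittingLaw Λ) :=
    ⟨(MeasurableEquiv.curry ℕ+ Label Life).measurable,
      Measure.infinitePi_map_curry fun _ _ => lifeLaw Λ⟩
  exact ((MeasurePreserving.id (lifeLaw Λ)).prod h2).comp h1

end Laws

/-! ### Labels of daughters -/

/-- On `F`, the number of strictly larger elements is strictly decreasing in the age. -/
lemma daughterLabel_injOn {F : Finset ℝ} {a b : ℝ} (ha : a ∈ F) (hb : b ∈ F)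
    (h : daughterLabel F a = daughterLabel F b) : a = b := by
  have key : ∀ x y : ℝ, y ∈ F → x < y →
      (F.filter (y < ·)).card < (F.filter (x < ·)).card := fun x y hy hxy => by
    refine Finset.card_lt_card ⟨fun f hf => ?_, fun hs => ?_⟩
    · simp only [Finset.mem_filter] at hf ⊢
      exact ⟨hf.1, hxy.trans hf.2⟩
    · have : y ∈ F.filter (y < ·) := hs (by simp [hy, hxy])
      simp at this
  have h' : (F.filter (a < ·)).card = (F.filter (b < ·)).card := Nat.succPNat_injective h
  rcases lt_trichotomy a b with hab | hab | hab
  · exact absurd h' (key a b hb hab).ne'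
  · exact hab
  · exact absurd h' (key b a ha hab).ne

lemma daughterLabel_lt {F : Finset ℝ} {a : ℝ} (ha : a ∈ F) :
    (F.filter (a < ·)).card < F.card :=
  Finset.card_lt_card ⟨Finset.filter_subset _ _, fun hs => by
    have : a ∈ F.filter (a < ·) := hs ha
    simp at this⟩

/-- Age of an individual at the birth coded by the `i`-th point of her configuration. -/
noncomputable def childAge (ℓ : Life) (i : ℕ) : ℝ := ℓ.1 * ℓ.2.2 i

lemma birthAges_eq (ℓ : Life) : birthAges ℓ = (Finset.range ℓ.2.1).image (childAge ℓ) := rfl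

/-- Label of the daughter coded by the `i`-th point of the configuration, extended injectively to
the unused points. -/
noncomputable def childLabel (ℓ : Life) (i : ℕ) : ℕ+ :=
  if i < ℓ.2.1 then daughterLabel (birthAges ℓ) (childAge ℓ i) else Nat.succPNat i

/-- The lives of the descendants of the daughter coded by the `i`-th point. -/
noncomputable def offspring (d : Label → Life) (i : ℕ) : Label → Life :=
  fun v => d (childLabel (d []) i :: v)

/-- Configurations of distinct interior points. -/
def GoodConfig (c : Config) : Prop := (∀ i, 0 < c.2 i ∧ c.2 i < 1) ∧ Function.Injective c.2

def GoodLife (ℓ : Life) : Prop := 0 < ℓ.1 ∧ GoodConfig ℓ.2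

def GoodLives (d : Label → Life) : Prop := ∀ u, GoodLife (d u)

lemma GoodLives.offspring {d : Label → Life} (hd : GoodLives d) (i : ℕ) :
    GoodLives (offspring d i) := fun _ => hd _

lemma GoodLife.childAge_injective {ℓ : Life} (h : GoodLife ℓ) :
    Function.Injective (childAge ℓ) := fun _ _ hij =>
  h.2.2 (mul_left_cancel₀ h.1.ne' hij)

lemma GoodLife.childAge_pos {ℓ : Life} (h : GoodLife ℓ) (i : ℕ) : 0 < childAge ℓ i :=
  mul_pos h.1 (h.2.1 i).1

lemma childAge_mem {ℓ : Life} {i : ℕ} (hi : i < ℓ.2.1) : childAge ℓ i ∈ birthAges ℓ :=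
  Finset.mem_image_of_mem _ (Finset.mem_range.2 hi)

/-- Injectivity on all of `ℕ` is what makes the subtrees, indexed by points, an i.i.d. sequence.
Labels of actual daughters come from ranks below the number of points, while an unused index keeps
itself as rank, so that the two kinds never collide. -/
lemma GoodLife.childLabel_injective {ℓ : Life} (h : GoodLife ℓ) :
    Function.Injective (childLabel ℓ) := by
  have key : ∀ i, i < ℓ.2.1 → ((birthAges ℓ).filter (childAge ℓ i < ·)).card < ℓ.2.1 :=
    fun i hi => (daughterLabel_lt (childAge_mem hi)).trans_le
      (Finset.card_image_le.trans_eq (Finset.card_range _))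
  intro i j hij
  unfold childLabel at hij
  split_ifs at hij with hi hj hj
  · exact h.childAge_injective (daughterLabel_injOn (childAge_mem hi) (childAge_mem hj) hij)
  · exact absurd (Nat.succPNat_injective hij) ((key i hi).trans_le (not_lt.1 hj)).ne
  · exact absurd (Nat.succPNat_injective hij) ((key j hj).trans_le (not_lt.1 hi)).ne'
  · exact Nat.succPNat_injective hij

instance : MeasurableSpace ℕ+ := ⊤

instance : DiscreteMeasurableSpace ℕ+ := ⟨fun _ => trivial⟩

/-! ### Random finite sets of reals -/

section Measurability

variable {Ω : Type*} [MeasurableSpace Ω]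

/-- A random finite set of reals whose membership and counting functions are measurable. -/
structure MeasurableFinset (F : Ω → Finset ℝ) : Prop where
  mem : ∀ a : Ω → ℝ, Measurable a → Measurable fun ω => a ω ∈ F ω
  card : ∀ a : Ω → ℝ, Measurable a → Measurable fun ω => ((F ω).filter (a ω < ·)).card

lemma MeasurableFinset.empty : MeasurableFinset fun _ : Ω => (∅ : Finset ℝ) :=
  ⟨fun a _ => by simp, fun a _ => by simp⟩

lemma MeasurableFinset.insert {F : Ω → Finset ℝ} (hF : MeasurableFinset F) {f : Ω → ℝ}
    (hf : Measurable f) : MeasurableFinset fun ω => insert (f ω) (F ω) := by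
  refine ⟨fun a ha => ?_, fun a ha => ?_⟩
  · simp only [Finset.mem_insert]
    exact (measurableSet_setOfPred.1 (measurableSet_eq_fun ha hf)).or (hF.mem a ha)
  · have : (fun ω => ((Insert.insert (f ω) (F ω)).filter (a ω < ·)).card) = fun ω =>
        ((F ω).filter (a ω < ·)).card +
          ({ω | a ω < f ω ∧ f ω ∉ F ω}.indicator (fun _ => 1) ω) := by
      funext ω
      by_cases h1 : f ω ∈ F ω
      · simp [h1]
      · by_cases h2 : a ω < f ω
        · rw [Finset.filter_insert, if_pos h2, Finset.card_insert_of_notMem (by simp [h1])]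
          simp [h1, h2]
        · simp [Finset.filter_insert, h1, h2]
    rw [this]
    refine (hF.card a ha).add (measurable_const.indicator ?_)
    exact (measurableSet_lt ha hf).inter (measurableSet_setOfPred.2 (hF.mem f hf).not)

lemma MeasurableFinset.image_range {f : ℕ → Ω → ℝ} (hf : ∀ i, Measurable (f i)) (n : ℕ) :
    MeasurableFinset fun ω => (Finset.range n).image fun i => f i ω := by
  induction n with
  | zero => simpa using MeasurableFinset.empty
  | succ n ih =>
    simp only [Finset.range_add_one, Finset.image_insert]
    exact ih.insert (hf n)

lemma measurable_of_countable_index {β : Type*} [MeasurableSpace β] {N : Ω → ℕ}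
    (hN : Measurable N) {g : ℕ → Ω → β} (hg : ∀ n, Measurable (g n)) :
    Measurable fun ω => g (N ω) ω := by
  have : Measurable (fun p : ℕ × Ω => g p.1 p.2) := measurable_from_prod_countable_right hg
  exact this.comp (hN.prodMk measurable_id)

lemma MeasurableFinset.points {z : Ω → ℝ} {c : Ω → Config} (hz : Measurable z)
    (hc : Measurable c) : MeasurableFinset fun ω => points (z ω) (c ω) := by
  have hf : ∀ i, Measurable fun ω => z ω * (c ω).2 i := fun i => by fun_prop
  exact ⟨fun a ha => measurable_of_countable_index hc.fst
      fun n => (MeasurableFinset.image_range hf n).mem a ha,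
    fun a ha => measurable_of_countable_index hc.fst
      fun n => (MeasurableFinset.image_range hf n).card a ha⟩

lemma MeasurableFinset.daughterLabel {F : Ω → Finset ℝ} (hF : MeasurableFinset F) {a : Ω → ℝ}
    (ha : Measurable a) : Measurable fun ω => daughterLabel (F ω) (a ω) :=
  (Measurable.of_discrete (f := Nat.succPNat)).comp (hF.card a ha)

end Measurability

lemma measurable_birthAges : MeasurableFinset birthAges :=
  .points measurable_fst measurable_snd

@[fun_prop]
lemma measurable_childAge (i : ℕ) : Measurable fun ℓ => childAge ℓ i := by
  unfold childAge; fun_prop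

@[fun_prop]
lemma measurable_childLabel (i : ℕ) : Measurable fun ℓ => childLabel ℓ i := by
  refine Measurable.ite ?_ (measurable_birthAges.daughterLabel (measurable_childAge i))
    measurable_const
  exact measurableSet_lt measurable_const (by fun_prop)

lemma measurable_apply_random {X : Type*} [MeasurableSpace X] {Ω : Type*} [MeasurableSpace Ω]
    {l : Ω → ℕ+} (hl : Measurable l) {f : Ω → ℕ+ → X} (hf : Measurable f) :
    Measurable fun ω => f ω (l ω) := by
  have : Measurable (fun p : ℕ+ × Ω => f p.2 p.1) :=
    measurable_from_prod_countable_right fun j => (measurable_pi_apply j).comp hf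
  exact this.comp (hl.prodMk measurable_id)

/-! ### Almost sure properties -/

instance : NullSingletonClass unif := by unfold unif; infer_instance

lemma ae_mem_unif : ∀ᵐ u ∂unif, 0 < u ∧ u < 1 := by
  unfold unif
  exact (ae_restrict_iff' measurableSet_Ioo).2 (Eventually.of_forall fun _ h => h)

lemma ae_points : ∀ᵐ f ∂(Measure.infinitePi fun _ : ℕ => unif),
    (∀ i, 0 < f i ∧ f i < 1) ∧ Function.Injective f := by
  refine (ae_all_iff.2 fun i => ?_).and ?_
  · exact (measurePreserving_eval_infinitePi (fun _ : ℕ => unif) i).quasiMeasurePreserving.ae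
      ae_mem_unif
  · have h : ∀ i j : ℕ, i ≠ j →
        ∀ᵐ f ∂(Measure.infinitePi fun _ : ℕ => unif), f i ≠ f j := fun i j hij => by
      have hmp : MeasurePreserving (fun f : ℕ → ℝ => (f i, f j))
          (Measure.infinitePi fun _ : ℕ => unif) (unif.prod unif) :=
        ⟨by fun_prop, Measure.infinitePi_map_eval_prod hij⟩
      have h0 : ∀ᵐ p ∂(unif.prod unif), p.1 ≠ p.2 := by
        rw [ae_iff, Measure.measure_prod_null]
        · refine Eventually.of_forall fun x => ?_
          have : Prod.mk x ⁻¹' {p : ℝ × ℝ | ¬p.1 ≠ p.2} = {x} := by ext y; simp [eq_comm]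
          change unif (Prod.mk x ⁻¹' {p : ℝ × ℝ | ¬p.1 ≠ p.2}) = 0
          rw [this]; simp
        · simpa using measurableSet_eq_fun measurable_fst measurable_snd
      exact hmp.quasiMeasurePreserving.ae h0
    filter_upwards [ae_all_iff.2 fun i => ae_all_iff.2 fun j => eventually_imp_distrib_left.2 (h i j)]
      with f hf i j hij
    by_contra hne
    exact hf i j hne hij

lemma poissonKernel_apply (b : ℝ≥0) (z : ℝ) : poissonKernel b z =
    (poissonMeasure (b * z.toNNReal)).prod (Measure.infinitePi fun _ : ℕ => unif) := by
  have : IsMarkovKernel (⟨fun z => poissonMeasure (b * z.toNNReal),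
      measurable_poissonMeasure.comp (by fun_prop)⟩ : Kernel ℝ ℕ) :=
    ⟨fun z => inferInstanceAs (IsProbabilityMeasure (poissonMeasure (b * z.toNNReal)))⟩
  rw [poissonKernel, Kernel.prod_apply]
  rfl

lemma ae_goodConfig (b : ℝ≥0) (z : ℝ) : ∀ᵐ c ∂(poissonKernel b z), GoodConfig c := by
  rw [poissonKernel_apply]
  exact Measure.quasiMeasurePreserving_snd.ae ae_points

lemma measurable_goodConfig : Measurable GoodConfig := by
  unfold GoodConfig Function.Injective
  refine Measurable.and ?_ ?_
  · refine Measurable.forall fun i => ?_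
    have hi : Measurable fun c : Config => c.2 i := by fun_prop
    exact measurableSet_setOfPred.1 ((measurableSet_lt measurable_const hi).inter
      (measurableSet_lt hi measurable_const))
  · refine Measurable.forall fun i => Measurable.forall fun j => Measurable.imp ?_ measurable_const
    exact measurableSet_setOfPred.1 (measurableSet_eq_fun (by fun_prop) (by fun_prop))

section Laws

variable (Λ : Measure ℝ) [IsFiniteMeasure Λ] [NeZero Λ]

omit [NeZero Λ] in
lemma ae_goodLife (h0 : Λ (Iic 0) = 0) : ∀ᵐ ℓ ∂(lifeLaw Λ), GoodLife ℓ := by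
  have hm : MeasurableSet {ℓ : Life | GoodLife ℓ} := by
    refine (measurableSet_lt measurable_const measurable_fst).inter ?_
    exact measurableSet_setOfPred.2 (measurable_goodConfig.comp measurable_snd)
  unfold lifeLaw
  refine (Measure.ae_compProd_iff hm).2 ?_
  have : ∀ᵐ z ∂Λ, 0 < z := by
    simp only [ae_iff, not_lt]; exact h0
  filter_upwards [Measure.ae_smul_measure this _] with z hz
  filter_upwards [ae_goodConfig (birthRate Λ) z] with c hc using ⟨hz, hc⟩

lemma ae_goodLives (h0 : Λ (Iic 0) = 0) : ∀ᵐ d ∂(splittingLaw Λ), GoodLives d :=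
  ae_all_iff.2 fun u => (measurePreserving_eval_infinitePi (fun _ : Label => lifeLaw Λ)
    u).quasiMeasurePreserving.ae (ae_goodLife Λ h0)

/-- The law of the lives of the descendants of the daughters, indexed by points. -/
lemma measurePreserving_offspring (h0 : Λ (Iic 0) = 0) :
    MeasurePreserving (fun d : Label → Life => (d [], offspring d))
      (splittingLaw Λ) ((lifeLaw Λ).prod (Measure.infinitePi fun _ : ℕ => splittingLaw Λ)) := by
  have h1 : MeasurePreserving (fun p : Life × (ℕ+ → Label → Life) =>
      (p.1, fun i => p.2 (childLabel p.1 i)))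
      ((lifeLaw Λ).prod (Measure.infinitePi fun _ : ℕ+ => splittingLaw Λ))
      ((lifeLaw Λ).prod (Measure.infinitePi fun _ : ℕ => splittingLaw Λ)) := by
    -- Conditionally on the life of the ancestor the relabelling is a fixed injection, and selecting
    -- coordinates along an injection preserves an i.i.d. law.
    refine (MeasurePreserving.id _).skew_product
      (g := fun (ℓ : Life) (e : ℕ+ → Label → Life) (i : ℕ) => e (childLabel ℓ i)) ?_ ?_
    · refine measurable_pi_lambda _ fun i => ?_
      exact measurable_apply_random ((measurable_childLabel i).comp measurable_fst) measurable_snd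
    · filter_upwards [ae_goodLife Λ h0] with ℓ hℓ
      exact Measure.map_infinitePi_infinitePi_of_inj hℓ.childLabel_injective
  exact h1.comp (measurePreserving_root_daughters Λ)

end Laws

/-! ### Size biasing -/

/-- The increasing enumeration of the indices different from `i`. -/
def skip (i k : ℕ) : ℕ := if k < i then k else k + 1

lemma skip_injective (i : ℕ) : Function.Injective (skip i) := fun a b h => by
  unfold skip at h; split_ifs at h <;> omega

lemma skip_ne (i k : ℕ) : skip i k ≠ i := by
  unfold skip; split_ifs <;> omega

lemma skip_lt {i k n : ℕ} (hi : i < n) (hk : k < n - 1) : skip i k < n := by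
  unfold skip; split_ifs <;> omega

lemma exists_skip_eq {i j n : ℕ} (hi : i < n) (hj : j < n) (hij : j ≠ i) :
    ∃ k < n - 1, skip i k = j := by
  rcases lt_or_gt_of_ne hij with h | h
  · exact ⟨j, by omega, by simp [skip, h]⟩
  · exact ⟨j - 1, by omega, by unfold skip; split_ifs <;> omega⟩

/-- Data of one individual of the spine: `(A, R)`, the grafting points, and the lives of the
individuals of the grafted trees. -/
abbrev StepData : Type := ((ℝ × ℝ) × Config) × (ℕ → Label → Life)

/-- An individual, seen as an individual of a spine which goes on with her `i`-th daughter. -/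
noncomputable def spineView (ℓ : Life) (e : ℕ → Label → Life) (i : ℕ) :
    StepData × (Label → Life) :=
  ((((ℓ.2.2 i * ℓ.1, (1 - ℓ.2.2 i) * ℓ.1), (ℓ.2.1 - 1, fun k => ℓ.2.2 (skip i k))),
    fun k => e (skip i k)), e i)

@[fun_prop]
lemma measurable_spineView (i : ℕ) :
    Measurable fun p : Life × (ℕ → Label → Life) => spineView p.1 p.2 i := by
  unfold spineView
  have : Measurable fun p : Life × (ℕ → Label → Life) => p.1.2.1 - 1 :=
    (Measurable.of_discrete (f := fun n : ℕ => n - 1)).comp (by fun_prop)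
  fun_prop

/-- The law of `(A, R)` and of the grafting points on one individual of the spine. -/
noncomputable def stepConfigLaw (Λ : Measure ℝ) : Measure ((ℝ × ℝ) × Config) :=
  stepLaw Λ ⊗ₘ (poissonKernel (birthRate Λ)).comap (fun p => p.1 + p.2) (by fun_prop)

/-- The law of the data of one individual of the spine. -/
noncomputable def stepDataLaw (Λ : Measure ℝ) : Measure StepData :=
  (stepConfigLaw Λ).prod (Measure.infinitePi fun _ : ℕ => splittingLaw Λ)

/-- A size-biased Poisson variable is a Poisson variable plus one. -/
lemma poissonMeasure_succ_mul (r : ℝ≥0) (n : ℕ) :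
    ((n + 1 : ℕ) : ℝ≥0∞) * poissonMeasure r {n + 1} = r * poissonMeasure r {n} := by
  rw [poissonMeasure_singleton, poissonMeasure_singleton, ← ENNReal.ofReal_natCast,
    ← ENNReal.ofReal_coe_nnreal, ← ENNReal.ofReal_mul (by positivity),
    ← ENNReal.ofReal_mul (by positivity)]
  congr 1
  rw [Nat.factorial_succ]
  push_cast
  have := Nat.factorial_pos n
  field_simp
  ring

/-- Marking one of the births and removing it leaves a Poisson number of births. The factor `r`,
which will be `b * z`, is the source of the size bias of the lifetime. -/
lemma lintegral_poissonMeasure_size_biased (r : ℝ≥0) (K : ℕ → ℝ≥0∞) :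
    ∫⁻ n, n * K (n - 1) ∂(poissonMeasure r) = r * ∫⁻ n, K n ∂(poissonMeasure r) := by
  rw [lintegral_countable', lintegral_countable', tsum_eq_zero_add' ENNReal.summable,
    ← ENNReal.tsum_mul_left]
  simp only [Nat.cast_zero, zero_mul, zero_add, Nat.add_sub_cancel]
  refine tsum_congr fun n => ?_
  rw [mul_right_comm, poissonMeasure_succ_mul]
  ring

/-! ### The many-to-one formula -/

section Laws

variable (Λ : Measure ℝ) [IsFiniteMeasure Λ] [NeZero Λ]

omit [IsFiniteMeasure Λ] [NeZero Λ] in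
lemma isProbabilityMeasure_sizeBiased (h0 : meanOffspring Λ ≠ 0) (h1 : meanOffspring Λ ≠ ∞) :
    IsProbabilityMeasure (sizeBiased Λ) := by
  constructor
  simp only [sizeBiased, Measure.smul_apply, smul_eq_mul,
    withDensity_apply _ MeasurableSet.univ, Measure.restrict_univ]
  exact ENNReal.inv_mul_cancel h0 h1

variable [IsProbabilityMeasure (sizeBiased Λ)]

instance : IsProbabilityMeasure (stepLaw Λ) :=
  Measure.isProbabilityMeasure_map (by fun_prop)

instance : IsProbabilityMeasure (stepConfigLaw Λ) := by unfold stepConfigLaw; infer_instance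

instance : IsProbabilityMeasure (stepDataLaw Λ) := by unfold stepDataLaw; infer_instance

/-- Integral over the points, the grafts and the spinal daughter of an individual of the spine
with lifetime `z` and `n` grafting points. -/
noncomputable def stepIntegral (H : StepData × (Label → Life) → ℝ≥0∞) (z : ℝ) (n : ℕ) : ℝ≥0∞ :=
  ∫⁻ r, H ((((r.1.1 * z, (1 - r.1.1) * z), (n, r.1.2)), r.2.2), r.2.1)
    ∂((unif.prod (Measure.infinitePi fun _ : ℕ => unif)).prod
      ((splittingLaw Λ).prod (Measure.infinitePi fun _ : ℕ => splittingLaw Λ)))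

omit [IsProbabilityMeasure (sizeBiased Λ)] in
-- By exchangeability the marked index plays no role: the `i`-th point and subtree are independent
-- of the others, which `skip i` enumerates as i.i.d. sequences.
lemma lintegral_spineView {H : StepData × (Label → Life) → ℝ≥0∞} (hH : Measurable H)
    (z : ℝ) (n i : ℕ) :
    ∫⁻ f, ∫⁻ e, H (spineView (z, (n, f)) e i) ∂(Measure.infinitePi fun _ : ℕ => splittingLaw Λ)
      ∂(Measure.infinitePi fun _ : ℕ => unif) = stepIntegral Λ H z (n - 1) := by
  have hmp := (measurePreserving_eval_comp unif (skip_injective i) (skip_ne i)).prod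
    (measurePreserving_eval_comp (splittingLaw Λ) (skip_injective i) (skip_ne i))
  have hm : Measurable fun r : (ℝ × (ℕ → ℝ)) × ((Label → Life) × (ℕ → Label → Life)) =>
      H ((((r.1.1 * z, (1 - r.1.1) * z), (n - 1, r.1.2)), r.2.2), r.2.1) := by fun_prop
  rw [stepIntegral, ← hmp.lintegral_comp hm, lintegral_prod]
  · rfl
  · exact (hm.comp hmp.measurable).aemeasurable

omit [IsProbabilityMeasure (sizeBiased Λ)] in
-- Given `n` births, the sum consists of `n` equal integrals. The Poisson size bias turns the factor
-- `n` into `b * z`, and `b` cancels against the normalization of the lifetime law `Λ / b`.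
lemma lintegral_sum_spineView (h0 : Λ (Iic 0) = 0) {H : StepData × (Label → Life) → ℝ≥0∞}
    (hH : Measurable H) :
    ∫⁻ d, ∑ i ∈ Finset.range (d []).2.1, H (spineView (d []) (offspring d) i) ∂(splittingLaw Λ) =
      ∫⁻ z, ENNReal.ofReal z *
        ∫⁻ n, stepIntegral Λ H z n ∂(poissonMeasure (birthRate Λ * z.toNNReal)) ∂Λ := by
  have hG : Measurable fun p : Life × (ℕ → Label → Life) =>
      ∑ i ∈ Finset.range p.1.2.1, H (spineView p.1 p.2 i) :=
    measurable_of_countable_index (N := fun p : Life × (ℕ → Label → Life) => p.1.2.1)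
      (g := fun n p => ∑ i ∈ Finset.range n, H (spineView p.1 p.2 i)) (by fun_prop)
      fun n => Finset.measurable_fun_sum _ fun i _ => hH.comp (measurable_spineView i)
  have hcp : Measurable fun ℓ : Life => ∫⁻ e, ∑ i ∈ Finset.range ℓ.2.1, H (spineView ℓ e i)
      ∂(Measure.infinitePi fun _ : ℕ => splittingLaw Λ) := hG.lintegral_prod_right'
  have hb : (birthRate Λ : ℝ≥0∞) * (Λ univ)⁻¹ = 1 := by
    rw [birthRate, ENNReal.coe_toNNReal (measure_ne_top _ _)]
    exact ENNReal.mul_inv_cancel (NeZero.ne (Λ univ)) (measure_ne_top Λ _)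
  have hz : ∀ z : ℝ, ∫⁻ c, ∫⁻ e, ∑ i ∈ Finset.range c.1, H (spineView (z, c) e i)
        ∂(Measure.infinitePi fun _ : ℕ => splittingLaw Λ) ∂(poissonKernel (birthRate Λ) z) =
      birthRate Λ * (ENNReal.ofReal z *
        ∫⁻ n, stepIntegral Λ H z n ∂(poissonMeasure (birthRate Λ * z.toNNReal))) := fun z => by
    rw [poissonKernel_apply, lintegral_prod _ (by exact (hcp.comp measurable_prodMk_left).aemeasurable)]
    have : ∀ n : ℕ, ∫⁻ f, ∫⁻ e, ∑ i ∈ Finset.range n, H (spineView (z, (n, f)) e i)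
        ∂(Measure.infinitePi fun _ : ℕ => splittingLaw Λ)
        ∂(Measure.infinitePi fun _ : ℕ => unif) = n * stepIntegral Λ H z (n - 1) := fun n => by
      have hm : ∀ i, Measurable fun q : (ℕ → ℝ) × (ℕ → Label → Life) =>
          H (spineView (z, (n, q.1)) q.2 i) := fun i =>
        (hH.comp (measurable_spineView i)).comp
          (f := fun q : (ℕ → ℝ) × (ℕ → Label → Life) => ((z, (n, q.1)), q.2)) (by fun_prop)
      have h1 : ∀ f : ℕ → ℝ, ∫⁻ e, ∑ i ∈ Finset.range n, H (spineView (z, (n, f)) e i)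
          ∂(Measure.infinitePi fun _ : ℕ => splittingLaw Λ) =
          ∑ i ∈ Finset.range n, ∫⁻ e, H (spineView (z, (n, f)) e i)
            ∂(Measure.infinitePi fun _ : ℕ => splittingLaw Λ) := fun f =>
        lintegral_finsetSum _ fun i _ => (hm i).comp measurable_prodMk_left
      simp_rw [h1]
      rw [lintegral_finsetSum _ fun i _ => (hm i).lintegral_prod_right']
      simp [lintegral_spineView Λ hH]
    simp_rw [this]
    rw [lintegral_poissonMeasure_size_biased, ENNReal.coe_mul, mul_assoc]
    rfl
  rw [(measurePreserving_offspring Λ h0).lintegral_comp hG, lintegral_prod _ hG.aemeasurable,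
    lifeLaw, Measure.lintegral_compProd hcp]
  simp_rw [hz]
  rw [lintegral_smul_measure, lintegral_const_mul' _ _ ENNReal.coe_ne_top, smul_eq_mul,
    ← mul_assoc, mul_comm _ (birthRate Λ : ℝ≥0∞), hb, one_mul]

omit [IsFiniteMeasure Λ] [NeZero Λ] in
-- The law of the grafting points depends on `(A, R)` only through `A + R = U D + (1 - U) D = D`, so
-- the lifetime can be integrated last, as in `lintegral_sum_spineView`.
lemma lintegral_stepConfigLaw {G : (ℝ × ℝ) × Config → ℝ≥0∞} (hG : Measurable G) :
    ∫⁻ q, G q ∂(stepConfigLaw Λ) = ∫⁻ z, ∫⁻ n, ∫⁻ w, G ((w.1 * z, (1 - w.1) * z), (n, w.2))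
      ∂(unif.prod (Measure.infinitePi fun _ : ℕ => unif))
      ∂(poissonMeasure (birthRate Λ * z.toNNReal)) ∂(sizeBiased Λ) := by
  have hm : Measurable fun p : ℝ × ℝ => (p.1 * p.2, (1 - p.1) * p.2) := by fun_prop
  have h1 : Measurable fun p : ℝ × ℝ => ∫⁻ c, G (p, c)
      ∂((poissonKernel (birthRate Λ)).comap (fun p : ℝ × ℝ => p.1 + p.2) (by fun_prop) p) :=
    hG.lintegral_kernel_prod_right'
  rw [stepConfigLaw, Measure.lintegral_compProd hG, stepLaw, lintegral_map h1 hm,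
    lintegral_prod_symm _ (by exact (h1.comp hm).aemeasurable)]
  refine lintegral_congr fun z => ?_
  have hu : ∀ u : ℝ, u * z + (1 - u) * z = z := fun u => by ring
  simp only [Kernel.comap_apply, hu, poissonKernel_apply]
  have hG' : ∀ u, ∫⁻ c, G ((u * z, (1 - u) * z), c)
      ∂((poissonMeasure (birthRate Λ * z.toNNReal)).prod (Measure.infinitePi fun _ : ℕ => unif)) =
      ∫⁻ n, ∫⁻ f, G ((u * z, (1 - u) * z), (n, f)) ∂(Measure.infinitePi fun _ : ℕ => unif)
        ∂(poissonMeasure (birthRate Λ * z.toNNReal)) := fun u =>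
    lintegral_prod _ (by fun_prop)
  simp_rw [hG']
  rw [lintegral_lintegral_swap]
  · refine lintegral_congr fun n => ?_
    rw [lintegral_prod _ (by fun_prop)]
  · refine Measurable.aemeasurable ?_
    refine Measurable.lintegral_prod_right' (ν := Measure.infinitePi fun _ : ℕ => unif)
      (f := fun q : (ℝ × ℕ) × (ℕ → ℝ) => G ((q.1.1 * z, (1 - q.1.1) * z), (q.1.2, q.2))) ?_
    fun_prop

/-- **Many-to-one formula**: the sum over the daughters of the ancestor is given by the size-biased
individuals of the spine. -/
lemma many_to_one (h0 : Λ (Iic 0) = 0) (hm0 : meanOffspring Λ ≠ 0) (hm1 : meanOffspring Λ ≠ ∞)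
    {H : StepData × (Label → Life) → ℝ≥0∞} (hH : Measurable H) :
    ∫⁻ d, ∑ i ∈ Finset.range (d []).2.1, H (spineView (d []) (offspring d) i) ∂(splittingLaw Λ) =
      meanOffspring Λ * ∫⁻ q, ∫⁻ d, H (q, d) ∂(splittingLaw Λ) ∂(stepDataLaw Λ) := by
  have h1 : Measurable fun q : StepData => ∫⁻ d, H (q, d) ∂(splittingLaw Λ) :=
    hH.lintegral_prod_right'
  have h2 : Measurable fun q : (ℝ × ℝ) × Config => ∫⁻ e, ∫⁻ d, H ((q, e), d) ∂(splittingLaw Λ)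
      ∂(Measure.infinitePi fun _ : ℕ => splittingLaw Λ) := h1.lintegral_prod_right'
  rw [lintegral_sum_spineView Λ h0 hH, stepDataLaw, lintegral_prod _ h1.aemeasurable,
    lintegral_stepConfigLaw Λ h2, sizeBiased, lintegral_smul_measure, smul_eq_mul, ← mul_assoc,
    ENNReal.mul_inv_cancel hm0 hm1, one_mul,
    lintegral_withDensity_eq_lintegral_mul_non_measurable _ ENNReal.measurable_ofReal
      (Eventually.of_forall fun _ => ENNReal.ofReal_lt_top)]
  refine lintegral_congr fun z => ?_
  simp only [Pi.mul_apply]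
  congr 1
  refine lintegral_congr fun n => ?_
  rw [stepIntegral, lintegral_prod _ (by fun_prop)]
  refine lintegral_congr fun w => ?_
  rw [lintegral_prod_symm _ (by fun_prop)]

end Laws

/-! ### Grafting one generation -/

lemma mem_graftAt_singleton {l : ℕ+} {a s : ℝ} {u : Label} {T : Tree} :
    (u, s) ∈ graftAt [l] a T ↔ ∃ w, u = l :: w ∧ 0 < s - a ∧ (w, s - a) ∈ T := by
  constructor
  · rintro ⟨v, τ, h, hτ, hx⟩
    obtain ⟨rfl, rfl⟩ := Prod.ext_iff.1 hx
    exact ⟨v, rfl, by simpa using hτ, by simpa using h⟩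
  · rintro ⟨w, rfl, hs, h⟩
    exact ⟨w, s - a, h, hs, by simp⟩

/-- The life of an individual with lifetime `z`, without its origin. -/
def rootSegment (z : ℝ) : Tree := {x | x.1 = [] ∧ 0 < x.2 ∧ x.2 ≤ z}

/-- The part of a set of points that lies in the time window `(0, σ]`. -/
def window (σ : ℝ) (T : Tree) : Tree := {x ∈ T | 0 < x.2 ∧ x.2 ≤ σ}

/-- The part of a set of points that lies in the time window `(0, ∞)`. -/
def posPart (T : Tree) : Tree := {x ∈ T | 0 < x.2}

/-- The ages of an individual of the spine at all her births. -/
noncomputable def stepAges (q : StepData) : Finset ℝ :=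
  insert q.1.1.1 (points (q.1.1.1 + q.1.1.2) q.1.2)

/-- The tree that descends from an individual of the spine, if `T` is the one that descends from the
next individual of the spine. -/
noncomputable def stepTree (q : StepData) (T : Tree) : Tree :=
  {x | x ∈ rootSegment (q.1.1.1 + q.1.1.2) ∨
    x ∈ graftAt [daughterLabel (stepAges q) q.1.1.1] q.1.1.1 T ∨
    ∃ i, i < q.1.2.1 ∧
      x ∈ graftAt [daughterLabel (stepAges q) ((q.1.1.1 + q.1.1.2) * q.1.2.2 i)]
        ((q.1.1.1 + q.1.1.2) * q.1.2.2 i) (tree (q.2 i))}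

/-- The spine from one individual on, if `B` is the spine from the next individual on. -/
noncomputable def stepSpine (q : StepData) (B : Tree) : Tree :=
  {x | x ∈ rootSegment (q.1.1.1 + q.1.1.2) ∨
    x ∈ graftAt [daughterLabel (stepAges q) q.1.1.1] q.1.1.1 B}

/-- Having descendants `n` generations later. -/
def Reach : ℕ → (Label → Life) → Prop
  | 0, _ => True
  | n + 1, d => ∃ i, i < (d []).2.1 ∧ Reach n (offspring d i)

/-- The `i`-th daughter is the youngest one that has descendants `n` generations later. -/
def IsFirst (n : ℕ) (d : Label → Life) (i : ℕ) : Prop :=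
  Reach n (offspring d i) ∧
    ∀ j, j < (d []).2.1 → childAge (d []) i < childAge (d []) j → ¬ Reach n (offspring d j)

/-- The first lineage that reaches generation `n`, without the origin. -/
noncomputable def lineage : ℕ → (Label → Life) → Tree
  | 0, d => rootSegment (d []).1
  | n + 1, d => {x | x ∈ rootSegment (d []).1 ∨ ∃ i, (i < (d []).2.1 ∧ IsFirst n d i) ∧
      x ∈ graftAt [daughterLabel (birthAges (d [])) (childAge (d []) i)] (childAge (d []) i)
        (lineage n (offspring d i))}

/-- No tree that is grafted to the right of the spine reaches generation `n`. -/
def NoRight (n : ℕ) (q : StepData) : Prop :=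
  ∀ k, k < q.1.2.1 → q.1.1.1 < (q.1.1.1 + q.1.1.2) * q.1.2.2 k → ¬ Reach n (q.2 k)

lemma Reach.of_succ {n : ℕ} : ∀ {d : Label → Life}, Reach (n + 1) d → Reach n d := by
  induction n with
  | zero => intro d _; trivial
  | succ n ih => rintro d ⟨i, hi, h⟩; exact ⟨i, hi, ih h⟩

lemma Reach.anti {n m : ℕ} (h : n ≤ m) {d : Label → Life} (hd : Reach m d) : Reach n d := by
  induction h with
  | refl => exact hd
  | step _ ih => exact ih hd.of_succ

/-! ### Measurability -/

section Measurability

variable {Ω Ω' : Type*} [MeasurableSpace Ω] [MeasurableSpace Ω']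

/-- Random sets of points that are jointly measurable in time. -/
def MeasurableTree (X : Ω → Tree) : Prop := ∀ u, Measurable fun p : Ω × ℝ => (u, p.2) ∈ X p.1

lemma measurable_lt_prop {f g : Ω → ℝ} (hf : Measurable f) (hg : Measurable g) :
    Measurable fun ω => f ω < g ω := measurableSet_setOfPred.1 (measurableSet_lt hf hg)

lemma measurable_le_prop {f g : Ω → ℝ} (hf : Measurable f) (hg : Measurable g) :
    Measurable fun ω => f ω ≤ g ω := measurableSet_setOfPred.1 (measurableSet_le hf hg)

lemma measurable_natLt_prop {f : Ω → ℕ} (i : ℕ) (hf : Measurable f) :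
    Measurable fun ω => i < f ω := measurableSet_setOfPred.1 (measurableSet_lt measurable_const hf)

lemma MeasurableTree.measurable {X : Ω → Tree} (hX : MeasurableTree X) : Measurable X :=
  measurable_set_iff.2 fun x => (hX x.1).comp (measurable_id.prodMk measurable_const)

lemma MeasurableTree.comp {X : Ω → Tree} (hX : MeasurableTree X) {f : Ω' → Ω} (hf : Measurable f) :
    MeasurableTree fun ω => X (f ω) := fun u =>
  (hX u).comp ((hf.comp measurable_fst).prodMk measurable_snd)

lemma MeasurableTree.or {X Y : Ω → Tree} (hX : MeasurableTree X) (hY : MeasurableTree Y) :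
    MeasurableTree fun ω => {x | x ∈ X ω ∨ x ∈ Y ω} := fun u => (hX u).or (hY u)

lemma MeasurableTree.exists {X : ℕ → Ω → Tree} {p : ℕ → Ω → Prop} (hp : ∀ i, Measurable (p i))
    (hX : ∀ i, MeasurableTree (X i)) : MeasurableTree fun ω => {x | ∃ i, p i ω ∧ x ∈ X i ω} :=
  fun u => Measurable.exists fun i => ((hp i).comp measurable_fst).and (hX i u)

lemma MeasurableTree.rootSegment {z : Ω → ℝ} (hz : Measurable z) :
    MeasurableTree fun ω => rootSegment (z ω) := fun u =>
  show Measurable fun p : Ω × ℝ => u = [] ∧ 0 < p.2 ∧ p.2 ≤ z p.1 from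
    measurable_const.and ((measurable_lt_prop measurable_const measurable_snd).and
      (measurable_le_prop measurable_snd (hz.comp measurable_fst)))

/-- A grafted tree is evaluated at the random time `s - a`; measurability at each fixed time would
not suffice, hence the joint measurability in `MeasurableTree`. -/
lemma MeasurableTree.graftAt {X : Ω → Tree} (hX : MeasurableTree X) {l : Ω → ℕ+} {a : Ω → ℝ}
    (hl : Measurable l) (ha : Measurable a) :
    MeasurableTree fun ω => graftAt [l ω] (a ω) (X ω) := fun u => by
  simp only [mem_graftAt_singleton]
  have hs : Measurable fun p : Ω × ℝ => p.2 - a p.1 := by fun_prop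
  refine Measurable.exists fun w => Measurable.and ?_ (Measurable.and ?_ ?_)
  · exact ((Measurable.of_discrete (f := fun j : ℕ+ => u = j :: w)).comp hl).comp measurable_fst
  · exact measurable_lt_prop measurable_const hs
  · exact (hX w).comp (measurable_fst.prodMk hs)

lemma measurable_window (σ : ℝ) : Measurable (window σ) :=
  measurable_set_iff.2 fun x => (measurable_set_mem x).and measurable_const

lemma measurable_graftAt (l : ℕ+) (a : ℝ) : Measurable (graftAt [l] a) := by
  refine measurable_set_iff.2 fun x => ?_
  simp only [mem_graftAt_singleton (u := x.1) (s := x.2)]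
  exact Measurable.exists fun w => measurable_const.and
    (measurable_const.and (measurable_set_mem _))

/-- For fixed `q` the graft has a deterministic label and age, so the map is measurable for the
σ-field of trees itself. This allows an event for the whole tree to be pulled back to the subtree in
`stepEvent`. -/
lemma measurable_stepTree (q : StepData) : Measurable (stepTree q) :=
  measurable_set_iff.2 fun x => measurable_const.or
    ((measurable_set_iff.1 (measurable_graftAt _ _) x).or measurable_const)

lemma measurable_stepSpine (q : StepData) : Measurable (stepSpine q) :=
  measurable_set_iff.2 fun x => measurable_const.or
    (measurable_set_iff.1 (measurable_graftAt _ _) x)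

end Measurability

@[fun_prop]
lemma measurable_offspring (i : ℕ) : Measurable fun d : Label → Life => offspring d i := by
  refine measurable_pi_lambda _ fun v => ?_
  refine measurable_apply_random (l := fun d : Label → Life => childLabel (d []) i)
    (f := fun (d : Label → Life) (j : ℕ+) => d (j :: v)) ?_ (by fun_prop)
  exact (measurable_childLabel i).comp (measurable_pi_apply _)

lemma inTree_cons_iff {d : Label → Life} {j : ℕ+} {w : Label} {s : ℝ} :
    InTree d (j :: w) s ↔ ∃ i, i < (d []).2.1 ∧
      (daughterLabel (birthAges (d [])) (childAge (d []) i) = j ∧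
        0 < s - childAge (d []) i ∧ InTree (fun v => d (j :: v)) w (s - childAge (d []) i)) := by
  simp only [InTree]
  rw [birthAges_eq]
  simp [Finset.mem_image]

lemma measurableTree_tree : MeasurableTree tree := by
  intro u
  change Measurable fun p : (Label → Life) × ℝ => InTree p.1 u p.2
  induction u with
  | nil =>
    simp only [InTree]
    exact (measurable_le_prop measurable_const measurable_snd).and
      (measurable_le_prop measurable_snd (by fun_prop))
  | cons j w ih =>
    simp only [inTree_cons_iff]
    have hroot : Measurable fun p : (Label → Life) × ℝ => p.1 [] := by fun_prop
    refine Measurable.exists fun i => Measurable.and ?_ (Measurable.and ?_ (Measurable.and ?_ ?_))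
    · exact measurable_natLt_prop i (by fun_prop)
    · exact (((measurable_birthAges.daughterLabel (measurable_childAge i)).comp
        hroot)).eq_const j
    · exact measurable_lt_prop measurable_const
        (measurable_snd.sub ((measurable_childAge i).comp hroot))
    · exact ih.comp (f := fun p : (Label → Life) × ℝ =>
        ((fun v => p.1 (j :: v)), p.2 - childAge (p.1 []) i)) (by
          refine Measurable.prodMk (by fun_prop)
            (measurable_snd.sub ((measurable_childAge i).comp hroot)))

@[fun_prop]
lemma measurable_reach (n : ℕ) : Measurable (Reach n) := by
  induction n with
  | zero => exact measurable_const
  | succ n ih =>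
    exact Measurable.exists fun i => (measurable_natLt_prop i (by fun_prop)).and
      (ih.comp (measurable_offspring i))

lemma measurableSet_reach (n : ℕ) : MeasurableSet {d | Reach n d} :=
  measurableSet_setOfPred.2 (measurable_reach n)

lemma measurable_isFirst (n i : ℕ) : Measurable fun d => IsFirst n d i := by
  have hc : ∀ j, Measurable fun d : Label → Life => childAge (d []) j := fun j =>
    (measurable_childAge j).comp (measurable_pi_apply _)
  exact ((measurable_reach n).comp (measurable_offspring i)).and <|
    Measurable.forall fun j => (measurable_natLt_prop j (by fun_prop)).imp <|
      (measurable_lt_prop (hc i) (hc j)).imp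
        ((measurable_reach n).comp (measurable_offspring j)).not

lemma measurableTree_lineage (n : ℕ) : MeasurableTree (lineage n) := by
  induction n with
  | zero => exact MeasurableTree.rootSegment (by fun_prop)
  | succ n ih =>
    have hroot : Measurable fun d : Label → Life => d [] := by fun_prop
    refine (MeasurableTree.rootSegment (by fun_prop)).or (MeasurableTree.exists (fun i => ?_)
      fun i => ?_)
    · exact (measurable_natLt_prop i (by fun_prop)).and (measurable_isFirst n i)
    · exact (ih.comp (measurable_offspring i)).graftAt
        ((measurable_birthAges.daughterLabel (measurable_childAge i)).comp hroot)
        ((measurable_childAge i).comp hroot)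

lemma measurable_noRight (n : ℕ) : Measurable (NoRight n) := by
  refine Measurable.forall fun k => (measurable_natLt_prop k (by fun_prop)).imp <|
    (measurable_lt_prop (by fun_prop) (by fun_prop)).imp (Measurable.not ?_)
  exact (measurable_reach n).comp (by fun_prop)

lemma measurable_stepAges : MeasurableFinset stepAges :=
  (MeasurableFinset.points (by fun_prop) (by fun_prop)).insert (by fun_prop)

lemma MeasurableTree.stepTree {Ω : Type*} [MeasurableSpace Ω] {q : Ω → StepData} {X : Ω → Tree}
    (hq : Measurable q) (hX : MeasurableTree X) : MeasurableTree fun ω => stepTree (q ω) (X ω) := by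
  have hi : ∀ i, Measurable fun q : StepData => (q.1.1.1 + q.1.1.2) * q.1.2.2 i := by fun_prop
  have hA : Measurable fun q : StepData => q.1.1.1 := by fun_prop
  refine (MeasurableTree.rootSegment (by fun_prop)).or ((hX.graftAt
    ((measurable_stepAges.daughterLabel hA).comp hq) (hA.comp hq)).or
      (MeasurableTree.exists (fun i => ?_) fun i => ?_))
  · exact measurable_natLt_prop i (by fun_prop)
  · exact (measurableTree_tree.comp (by fun_prop)).graftAt
      ((measurable_stepAges.daughterLabel (hi i)).comp hq) ((hi i).comp hq)

lemma MeasurableTree.stepSpine {Ω : Type*} [MeasurableSpace Ω] {q : Ω → StepData} {X : Ω → Tree}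
    (hq : Measurable q) (hX : MeasurableTree X) :
    MeasurableTree fun ω => stepSpine (q ω) (X ω) := by
  have hA : Measurable fun q : StepData => q.1.1.1 := by fun_prop
  exact (MeasurableTree.rootSegment (by fun_prop)).or (hX.graftAt
    ((measurable_stepAges.daughterLabel hA).comp hq) (hA.comp hq))

/-! ### The tree and the daughters of the ancestor -/

lemma childLabel_of_lt {ℓ : Life} {i : ℕ} (hi : i < ℓ.2.1) :
    childLabel ℓ i = daughterLabel (birthAges ℓ) (childAge ℓ i) := if_pos hi

lemma inTree_cons_iff_offspring {d : Label → Life} {j : ℕ+} {w : Label} {s : ℝ} :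
    InTree d (j :: w) s ↔ ∃ i < (d []).2.1, childLabel (d []) i = j ∧
      0 < s - childAge (d []) i ∧ InTree (offspring d i) w (s - childAge (d []) i) := by
  rw [inTree_cons_iff]
  refine exists_congr fun i => and_congr_right fun hi => ?_
  rw [childLabel_of_lt hi]
  refine and_congr_right fun hj => ?_
  rw [← hj, ← childLabel_of_lt hi]
  rfl

lemma mem_posPart_tree {d : Label → Life} (hd : GoodLives d) {x : Label × ℝ} :
    x ∈ posPart (tree d) ↔ x ∈ rootSegment (d []).1 ∨ ∃ i, i < (d []).2.1 ∧
      x ∈ graftAt [daughterLabel (birthAges (d [])) (childAge (d []) i)] (childAge (d []) i)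
        (tree (offspring d i)) := by
  obtain ⟨u, s⟩ := x
  simp only [posPart, rootSegment, mem_ofPred_eq, mem_graftAt_singleton, tree]
  cases u with
  | nil =>
    simp only [InTree]
    constructor
    · rintro ⟨⟨_, h⟩, h'⟩; exact Or.inl ⟨trivial, h', h⟩
    · rintro (⟨_, h, h'⟩ | ⟨i, _, w, h, _⟩)
      · exact ⟨⟨h.le, h'⟩, h⟩
      · simp at h
  | cons j w =>
    rw [inTree_cons_iff_offspring]
    constructor
    · rintro ⟨⟨i, hi, hj, hs, h⟩, _⟩
      exact Or.inr ⟨i, hi, w, by rw [← hj, childLabel_of_lt hi], hs, h⟩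
    · rintro (⟨h, _⟩ | ⟨i, hi, w', h, hs, h'⟩)
      · simp at h
      · obtain ⟨rfl, rfl⟩ := List.cons.inj h
        refine ⟨⟨i, hi, childLabel_of_lt hi, hs, h'⟩, ?_⟩
        have := (hd []).childAge_pos i
        linarith

/-! ### The spinal decomposition of one generation -/

lemma spineView_lifetime (ℓ : Life) (e : ℕ → Label → Life) (i : ℕ) :
    (spineView ℓ e i).1.1.1.1 + (spineView ℓ e i).1.1.1.2 = ℓ.1 := by
  simp only [spineView]; ring

lemma spineView_age (ℓ : Life) (e : ℕ → Label → Life) (i : ℕ) :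
    (spineView ℓ e i).1.1.1.1 = childAge ℓ i := mul_comm _ _

lemma exists_lt_iff_skip {n i : ℕ} (hi : i < n) {p : ℕ → Prop} :
    (∃ j, j < n ∧ p j) ↔ p i ∨ ∃ k, k < n - 1 ∧ p (skip i k) := by
  constructor
  · rintro ⟨j, hj, h⟩
    by_cases hij : j = i
    · exact Or.inl (hij ▸ h)
    · obtain ⟨k, hk, rfl⟩ := exists_skip_eq hi hj hij
      exact Or.inr ⟨k, hk, h⟩
  · rintro (h | ⟨k, hk, h⟩)
    · exact ⟨i, hi, h⟩
    · exact ⟨_, skip_lt hi hk, h⟩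

lemma stepAges_spineView {ℓ : Life} (e : ℕ → Label → Life) {i : ℕ} (hi : i < ℓ.2.1) :
    stepAges (spineView ℓ e i).1 = birthAges ℓ := by
  ext a
  rw [stepAges, spineView_lifetime, spineView_age, birthAges_eq, Finset.mem_insert, points,
    Finset.mem_image, Finset.mem_image]
  simp only [Finset.mem_range]
  rw [exists_lt_iff_skip hi, eq_comm]
  rfl

/-- Any daughter can serve as the next spine individual. Her sisters become the grafts, and no label
changes because `stepAges` contains the ages at all births, the spinal one included. -/
lemma posPart_tree_eq_stepTree {d : Label → Life} (hd : GoodLives d) {i : ℕ}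
    (hi : i < (d []).2.1) : posPart (tree d) =
      stepTree (spineView (d []) (offspring d) i).1 (tree (offspring d i)) := by
  ext x
  rw [mem_posPart_tree hd, stepTree, mem_ofPred_eq, stepAges_spineView _ hi, spineView_lifetime,
    spineView_age, exists_lt_iff_skip hi]
  rfl

lemma isFirst_iff {n : ℕ} {d : Label → Life} {i : ℕ} (hi : i < (d []).2.1) :
    IsFirst n d i ↔ Reach n (offspring d i) ∧
      NoRight n (spineView (d []) (offspring d) i).1 := by
  refine and_congr_right fun _ => ?_
  rw [NoRight, spineView_lifetime, spineView_age]
  constructor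
  · intro h k hk hlt
    exact h _ (skip_lt hi hk) hlt
  · intro h j hj hlt
    -- A strictly younger sister is one of the other daughters, hence one of the grafts.
    have hij : j ≠ i := by rintro rfl; exact lt_irrefl _ hlt
    obtain ⟨k, hk, rfl⟩ := exists_skip_eq hi hj hij
    exact h k hk hlt

lemma exists_isFirst {n : ℕ} {d : Label → Life} (h : Reach (n + 1) d) :
    ∃ i < (d []).2.1, IsFirst n d i := by
  classical
  obtain ⟨i₀, hi₀, hr₀⟩ := h
  obtain ⟨i, hi, hmax⟩ := Finset.exists_max_image
    ((Finset.range (d []).2.1).filter fun i => Reach n (offspring d i)) (childAge (d []))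
    ⟨i₀, by simp [hi₀, hr₀]⟩
  simp only [Finset.mem_filter, Finset.mem_range] at hi hmax
  exact ⟨i, hi.1, hi.2, fun j hj hlt hr => absurd (hmax j ⟨hj, hr⟩) (not_le.2 hlt)⟩

lemma IsFirst.unique {n : ℕ} {d : Label → Life} (hd : GoodLives d) {i j : ℕ}
    (hi : i < (d []).2.1) (hj : j < (d []).2.1) (h : IsFirst n d i) (h' : IsFirst n d j) :
    i = j := by
  by_contra hij
  rcases lt_or_gt_of_ne ((hd []).childAge_injective.ne hij) with hlt | hlt
  · exact h.2 j hj hlt h'.1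
  · exact h'.2 i hi hlt h.1

lemma lineage_succ_eq_stepSpine {n : ℕ} {d : Label → Life} (hd : GoodLives d) {i : ℕ}
    (hi : i < (d []).2.1) (h : IsFirst n d i) : lineage (n + 1) d =
      stepSpine (spineView (d []) (offspring d) i).1 (lineage n (offspring d i)) := by
  ext x
  rw [lineage, stepSpine, mem_ofPred_eq, mem_ofPred_eq, stepAges_spineView _ hi,
    spineView_lifetime, spineView_age]
  refine or_congr_right ⟨?_, fun hx => ⟨i, ⟨hi, h⟩, hx⟩⟩
  rintro ⟨j, ⟨hj, h'⟩, hx⟩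
  obtain rfl := h.unique hd hi hj h'
  exact hx

/-! ### The first lineage -/

lemma pos_of_inTree_cons {d : Label → Life} (hd : GoodLives d) {j : ℕ+} {w : Label} {s : ℝ}
    (h : InTree d (j :: w) s) : 0 < s := by
  obtain ⟨i, _, _, hs, _⟩ := inTree_cons_iff_offspring.1 h
  have := (hd []).childAge_pos i
  linarith

lemma mem_individuals_tree {d : Label → Life} {u : Label} :
    u ∈ individuals (tree d) ↔ ∃ s, InTree d u s := by
  constructor
  · rintro ⟨⟨u, s⟩, h, rfl⟩; exact ⟨s, h⟩
  · rintro ⟨s, h⟩; exact ⟨(u, s), h, rfl⟩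

lemma nil_mem_individuals {d : Label → Life} (hd : GoodLives d) : [] ∈ individuals (tree d) :=
  mem_individuals_tree.2 ⟨0, le_rfl, (hd []).1.le⟩

lemma exists_pos_inTree {d : Label → Life} (hd : GoodLives d) {u : Label}
    (h : u ∈ individuals (tree d)) : ∃ s, 0 < s ∧ InTree d u s := by
  cases u with
  | nil => exact ⟨(d []).1, (hd []).1, (hd []).1.le, le_rfl⟩
  | cons j w =>
    obtain ⟨s, hs⟩ := mem_individuals_tree.1 h
    exact ⟨s, pos_of_inTree_cons hd hs, hs⟩

lemma cons_mem_individuals {d : Label → Life} (hd : GoodLives d) {j : ℕ+} {w : Label} :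
    j :: w ∈ individuals (tree d) ↔ ∃ i < (d []).2.1, childLabel (d []) i = j ∧
      w ∈ individuals (tree (offspring d i)) := by
  constructor
  · intro h
    obtain ⟨s, hs⟩ := mem_individuals_tree.1 h
    obtain ⟨i, hi, hj, _, h'⟩ := inTree_cons_iff_offspring.1 hs
    exact ⟨i, hi, hj, mem_individuals_tree.2 ⟨_, h'⟩⟩
  · rintro ⟨i, hi, hj, h⟩
    obtain ⟨s, hs, h'⟩ := exists_pos_inTree (hd.offspring i) h
    exact mem_individuals_tree.2 ⟨s + childAge (d []) i, inTree_cons_iff_offspring.2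
      ⟨i, hi, hj, by simpa using hs, by simpa using h'⟩⟩

lemma childLabel_cons_mem_individuals {d : Label → Life} (hd : GoodLives d) {i : ℕ} {w : Label}
    (hi : i < (d []).2.1) : childLabel (d []) i :: w ∈ individuals (tree d) ↔
      w ∈ individuals (tree (offspring d i)) := by
  rw [cons_mem_individuals hd]
  constructor
  · rintro ⟨j, _, hj, h⟩
    rwa [(hd []).childLabel_injective hj] at h
  · exact fun h => ⟨i, hi, rfl, h⟩

lemma individuals_prefix_closed {v : Label} : ∀ {d : Label → Life} {u : Label}, GoodLives d →
    u ∈ individuals (tree d) → v <+: u → v ∈ individuals (tree d) := by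
  induction v with
  | nil => intro d u hd _ _; exact nil_mem_individuals hd
  | cons j v ih =>
    rintro d u hd hu ⟨t, rfl⟩
    obtain ⟨i, hi, hj, h⟩ := (cons_mem_individuals hd).1 hu
    exact (cons_mem_individuals hd).2 ⟨i, hi, hj, ih (hd.offspring i) h ⟨t, rfl⟩⟩

lemma exists_individual_iff_reach {n : ℕ} : ∀ {d : Label → Life}, GoodLives d →
    ((∃ v ∈ individuals (tree d), v.length = n) ↔ Reach n d) := by
  induction n with
  | zero =>
    intro d hd
    simp only [Reach, iff_true]
    exact ⟨[], nil_mem_individuals hd, rfl⟩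
  | succ n ih =>
    intro d hd
    constructor
    · rintro ⟨v, hv, hn⟩
      cases v with
      | nil => simp at hn
      | cons j w =>
        obtain ⟨i, hi, _, h⟩ := (cons_mem_individuals hd).1 hv
        exact ⟨i, hi, (ih (hd.offspring i)).1 ⟨w, h, by simpa using hn⟩⟩
    · rintro ⟨i, hi, h⟩
      obtain ⟨w, hw, hn⟩ := (ih (hd.offspring i)).2 h
      exact ⟨childLabel (d []) i :: w, (childLabel_cons_mem_individuals hd hi).2 hw, by simp [hn]⟩

lemma genSize_ne_zero_iff {n : ℕ} {d : Label → Life} (hd : GoodLives d) :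
    genSize n (tree d) ≠ 0 ↔ Reach n d := by
  rw [← exists_individual_iff_reach hd, genSize, Set.encard_ne_zero]
  exact Iff.rfl

lemma hasDescendanceAt_cons {n : ℕ} {d : Label → Life} (hd : GoodLives d) {j : ℕ+} {w : Label} :
    HasDescendanceAt (tree d) (n + 1) (j :: w) ↔ ∃ i < (d []).2.1, childLabel (d []) i = j ∧
      HasDescendanceAt (tree (offspring d i)) n w := by
  constructor
  · rintro ⟨v, hv, hn, t, rfl⟩
    obtain ⟨i, hi, hj, h⟩ := (cons_mem_individuals hd).1 hv
    exact ⟨i, hi, hj, w ++ t, h, by simpa using hn, ⟨t, rfl⟩⟩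
  · rintro ⟨i, hi, hj, v, hv, hn, t, rfl⟩
    exact ⟨j :: (w ++ t), (cons_mem_individuals hd).2 ⟨i, hi, hj, hv⟩, by simpa using hn,
      ⟨t, rfl⟩⟩

lemma hasDescendanceAt_nil {n : ℕ} {d : Label → Life} (hd : GoodLives d) :
    HasDescendanceAt (tree d) n [] ↔ Reach n d := by
  rw [← exists_individual_iff_reach hd]
  simp [HasDescendanceAt]

lemma HasDescendanceAt.mem_individuals {n : ℕ} {d : Label → Life} (hd : GoodLives d) {u : Label}
    (h : HasDescendanceAt (tree d) n u) : u ∈ individuals (tree d) := by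
  obtain ⟨v, hv, _, hp⟩ := h
  exact individuals_prefix_closed hd hv hp

lemma birthLevel_nil {d : Label → Life} (hd : GoodLives d) : birthLevel (tree d) [] = 0 := by
  have : {s | (([] : Label), s) ∈ tree d} = Icc 0 (d []).1 := rfl
  rw [birthLevel, this, csInf_Icc (hd []).1.le]

/-- Grafting keeps positive times only. The only individual affected is the root, whose life becomes
half-open without a change of infimum. -/
lemma sInf_pos_inTree {d : Label → Life} (hd : GoodLives d) (w : Label) :
    sInf {s | 0 < s ∧ InTree d w s} = birthLevel (tree d) w := by
  cases w with
  | nil =>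
    have : {s | 0 < s ∧ InTree d [] s} = Ioc 0 (d []).1 := by
      ext s
      exact ⟨fun h => ⟨h.1, h.2.2⟩, fun h => ⟨h.1, h.1.le, h.2⟩⟩
    rw [this, birthLevel_nil hd, csInf_Ioc (hd []).1]
  | cons j w =>
    have : {s | 0 < s ∧ InTree d (j :: w) s} = {s | (j :: w, s) ∈ tree d} := by
      ext s
      exact ⟨fun h => h.2, fun h => ⟨pos_of_inTree_cons hd h, h⟩⟩
    rw [this]; rfl

lemma birthLevel_cons {d : Label → Life} (hd : GoodLives d) {i : ℕ} (hi : i < (d []).2.1)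
    {w : Label} (hw : w ∈ individuals (tree (offspring d i))) :
    birthLevel (tree d) (childLabel (d []) i :: w) =
      childAge (d []) i + birthLevel (tree (offspring d i)) w := by
  have h : {s | (childLabel (d []) i :: w, s) ∈ tree d} =
      OrderIso.addLeft (childAge (d []) i) '' {s | 0 < s ∧ InTree (offspring d i) w s} := by
    ext s
    change InTree d (childLabel (d []) i :: w) s ↔ _
    rw [inTree_cons_iff_offspring]
    constructor
    · rintro ⟨k, _, hk, hs, h⟩
      obtain rfl := (hd []).childLabel_injective hk
      exact ⟨_, ⟨hs, h⟩, by simp⟩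
    · rintro ⟨t, ⟨ht, h⟩, rfl⟩
      exact ⟨i, hi, rfl, by simpa using ht, by simpa using h⟩
  rw [birthLevel, h, ← OrderIso.map_csInf', sInf_pos_inTree (hd.offspring i)]
  · rfl
  · exact exists_pos_inTree (hd.offspring i) hw
  · exact ⟨0, fun s hs => hs.1.le⟩

lemma birthLevel_child {d : Label → Life} (hd : GoodLives d) {i : ℕ} (hi : i < (d []).2.1) :
    birthLevel (tree d) [childLabel (d []) i] = childAge (d []) i := by
  rw [birthLevel_cons hd hi (nil_mem_individuals (hd.offspring i)),
    birthLevel_nil (hd.offspring i), add_zero]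

/-- The condition on the first letter says that the daughter is the youngest with a long enough
progeny. The conditions on later letters compare birth levels within her subtree, where all levels
are shifted by the same age, so they are those of the first lineage of that subtree. -/
lemma isFirstLineage_succ {n : ℕ} {d : Label → Life} (hd : GoodLives d) {u : Label} :
    IsFirstLineage (tree d) (n + 1) u ↔ ∃ i < (d []).2.1, IsFirst n d i ∧
      ∃ w, u = childLabel (d []) i :: w ∧ IsFirstLineage (tree (offspring d i)) n w := by
  constructor
  · rintro ⟨hu, hn, h⟩
    cases u with
    | nil => simp at hn
    | cons j w =>
      obtain ⟨i, hi, rfl, hw⟩ := (cons_mem_individuals hd).1 hu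
      have hwn : w.length = n := by simpa using hn
      refine ⟨i, hi, ⟨?_, fun i' hi' hlt hr => ?_⟩, w, rfl, hw, hwn, fun k hk j' hj' => ?_⟩
      · exact (exists_individual_iff_reach (hd.offspring i)).1 ⟨w, hw, hwn⟩
      · have := h 0 n.succ_pos (childLabel (d []) i') (by
          simpa using (hasDescendanceAt_cons hd).2
            ⟨i', hi', rfl, (hasDescendanceAt_nil (hd.offspring i')).2 hr⟩)
        simp only [List.take_zero, List.nil_append, zero_add, List.take_succ_cons] at this
        rw [birthLevel_child hd hi', birthLevel_child hd hi] at this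
        exact absurd this (not_le.2 hlt)
      · have := h (k + 1) (Nat.succ_lt_succ hk) j' (by
          simpa using (hasDescendanceAt_cons hd).2 ⟨i, hi, rfl, hj'⟩)
        simp only [List.take_succ_cons, List.cons_append] at this
        rw [birthLevel_cons hd hi (hj'.mem_individuals (hd.offspring i)),
          birthLevel_cons hd hi (individuals_prefix_closed (hd.offspring i) hw
            (List.take_prefix _ _))] at this
        exact le_of_add_le_add_left this
  · rintro ⟨i, hi, hf, w, rfl, hw, hwn, h⟩
    refine ⟨(childLabel_cons_mem_individuals hd hi).2 hw, by simp [hwn], fun k hk j' hj' => ?_⟩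
    cases k with
    | zero =>
      simp only [List.take_zero, List.nil_append, zero_add, List.take_succ_cons] at hj' ⊢
      obtain ⟨i', hi', rfl, h'⟩ := (hasDescendanceAt_cons hd).1 hj'
      rw [birthLevel_child hd hi', birthLevel_child hd hi]
      by_contra hlt
      exact hf.2 i' hi' (not_le.1 hlt) ((hasDescendanceAt_nil (hd.offspring i')).1 h')
    | succ k =>
      simp only [List.take_succ_cons, List.cons_append] at hj' ⊢
      obtain ⟨i', hi', hl, h'⟩ := (hasDescendanceAt_cons hd).1 hj'
      obtain rfl := (hd []).childLabel_injective hl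
      rw [birthLevel_cons hd hi (h'.mem_individuals (hd.offspring i')),
          birthLevel_cons hd hi (individuals_prefix_closed (hd.offspring i') hw
            (List.take_prefix _ _))]
      exact add_le_add_right (h k (Nat.lt_of_succ_lt_succ hk) j' h') _

lemma exists_isFirstLineage {n : ℕ} : ∀ {d : Label → Life}, GoodLives d → Reach n d →
    ∃ u, IsFirstLineage (tree d) n u := by
  induction n with
  | zero => intro d hd _; exact ⟨[], nil_mem_individuals hd, rfl, by simp⟩
  | succ n ih =>
    intro d hd h
    obtain ⟨i, hi, hf⟩ := exists_isFirst h
    obtain ⟨w, hw⟩ := ih (hd.offspring i) hf.1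
    exact ⟨_, (isFirstLineage_succ hd).2 ⟨i, hi, hf, w, rfl, hw⟩⟩

/-- This identifies the distinguished lineage, defined through labels and birth levels, with the
recursive `lineage` to which the spinal decomposition applies. -/
lemma posPart_firstLineage {n : ℕ} : ∀ {d : Label → Life}, GoodLives d → Reach n d →
    posPart (firstLineage n (tree d)) = lineage n d := by
  induction n with
  | zero =>
    intro d hd _
    ext ⟨u, s⟩
    simp only [posPart, firstLineage, lineage, rootSegment, mem_ofPred_eq]
    constructor
    · rintro ⟨⟨hu, v, ⟨_, hv, _⟩, huv⟩, hs⟩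
      obtain rfl := List.length_eq_zero_iff.1 hv
      obtain rfl := List.prefix_nil.1 huv
      exact ⟨rfl, hs, hu.2⟩
    · rintro ⟨rfl, hs, hz⟩
      exact ⟨⟨⟨hs.le, hz⟩, [], ⟨nil_mem_individuals hd, rfl, by simp⟩, List.prefix_rfl⟩, hs⟩
  | succ n ih =>
    intro d hd hr
    ext ⟨u, s⟩
    simp only [lineage, mem_ofPred_eq, mem_graftAt_singleton]
    simp only [posPart, firstLineage, mem_ofPred_eq, rootSegment]
    cases u with
    | nil =>
      constructor
      · rintro ⟨⟨hu, _⟩, hs⟩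
        exact Or.inl ⟨rfl, hs, hu.2⟩
      · rintro (⟨_, hs, hz⟩ | ⟨i, _, w, h, _⟩)
        · obtain ⟨v, hv⟩ := exists_isFirstLineage hd hr
          exact ⟨⟨⟨hs.le, hz⟩, v, hv, List.nil_prefix⟩, hs⟩
        · simp at h
    | cons j w =>
      constructor
      · rintro ⟨⟨hu, v, hv, huv⟩, hs⟩
        obtain ⟨i, hi, hf, v', rfl, hv'⟩ := (isFirstLineage_succ hd).1 hv
        obtain ⟨rfl, hwv⟩ := List.cons_prefix_cons.1 huv
        obtain ⟨i', _, hl, hs', hw⟩ := inTree_cons_iff_offspring.1 hu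
        obtain rfl := (hd []).childLabel_injective hl
        refine Or.inr ⟨i', ⟨hi, hf⟩, w, by rw [childLabel_of_lt hi], hs', ?_⟩
        rw [← ih (hd.offspring i') hf.1]
        exact ⟨⟨hw, v', hv', hwv⟩, hs'⟩
      · rintro (⟨h, _⟩ | ⟨i, ⟨hi, hf⟩, w', h, hs, hw⟩)
        · simp at h
        · obtain ⟨rfl, rfl⟩ := List.cons.inj h
          rw [← ih (hd.offspring i) hf.1] at hw
          obtain ⟨⟨hw', v, hv, hwv⟩, _⟩ := hw
          rw [← childLabel_of_lt hi]
          refine ⟨⟨inTree_cons_iff_offspring.2 ⟨i, hi, rfl, hs, hw'⟩, _,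
            (isFirstLineage_succ hd).2 ⟨i, hi, hf, v, rfl, hv⟩,
            List.cons_prefix_cons.2 ⟨rfl, hwv⟩⟩, ?_⟩
          have := (hd []).childAge_pos i
          change 0 < s
          linarith

/-! ### Truncations -/

/-- The root being the only point at a nonpositive time, a truncation carries the same information
as the window `(0, σ]`. -/
lemma trunc_eq_of_root {T : Tree} (h0 : (([] : Label), (0 : ℝ)) ∈ T)
    (h : ∀ x ∈ T, x.2 ≤ 0 → x = ([], 0)) {σ : ℝ} (hσ : 0 < σ) :
    trunc σ T = insert ([], 0) (window σ T) := by
  ext x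
  simp only [trunc, window, mem_ofPred_eq, mem_insert_iff]
  constructor
  · rintro ⟨hx, hs⟩
    by_cases h' : 0 < x.2
    · exact Or.inr ⟨hx, h', hs⟩
    · exact Or.inl (h x hx (not_lt.1 h'))
  · rintro (rfl | ⟨hx, _, hs⟩)
    · exact ⟨h0, hσ.le⟩
    · exact ⟨hx, hs⟩

lemma eq_root_of_mem_tree {d : Label → Life} (hd : GoodLives d) {x : Label × ℝ} (hx : x ∈ tree d)
    (hs : x.2 ≤ 0) : x = ([], 0) := by
  obtain ⟨u, s⟩ := x
  cases u with
  | nil => exact Prod.ext rfl (le_antisymm hs hx.1)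
  | cons j w => exact absurd (pos_of_inTree_cons hd hx) (not_lt.2 hs)

lemma root_mem_tree {d : Label → Life} (hd : GoodLives d) : (([] : Label), (0 : ℝ)) ∈ tree d :=
  ⟨le_rfl, (hd []).1.le⟩

lemma window_posPart (σ : ℝ) (T : Tree) : window σ (posPart T) = window σ T := by
  ext x
  simp only [window, posPart, mem_ofPred_eq]
  tauto

lemma trunc_tree {d : Label → Life} (hd : GoodLives d) {σ : ℝ} (hσ : 0 < σ) :
    trunc σ (tree d) = insert ([], 0) (window σ (tree d)) :=
  trunc_eq_of_root (root_mem_tree hd) (fun _ => eq_root_of_mem_tree hd) hσ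

lemma trunc_firstLineage {n : ℕ} {d : Label → Life} (hd : GoodLives d) (hr : Reach n d) {σ : ℝ}
    (hσ : 0 < σ) :
    trunc σ (firstLineage n (tree d)) = insert ([], 0) (window σ (lineage n d)) := by
  rw [← posPart_firstLineage hd hr, window_posPart]
  obtain ⟨u, hu⟩ := exists_isFirstLineage hd hr
  exact trunc_eq_of_root (T := firstLineage n (tree d)) ⟨root_mem_tree hd, u, hu, List.nil_prefix⟩
    (fun x hx => eq_root_of_mem_tree hd hx.1) hσ

lemma window_graftAt (l : ℕ+) (a σ : ℝ) (T : Tree) :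
    window σ (graftAt [l] a T) = window σ (graftAt [l] a (window (σ - a) T)) := by
  ext ⟨u, s⟩
  simp only [window, mem_ofPred_eq, mem_graftAt_singleton]
  refine and_congr_left fun hs => exists_congr fun w => and_congr_right fun _ =>
    and_congr_right fun h0 => ?_
  exact ⟨fun h => ⟨h, h0, by linarith [hs.2]⟩, fun h => h.1⟩

lemma window_window {σ τ : ℝ} (h : σ ≤ τ) (T : Tree) : window σ (window τ T) = window σ T := by
  ext x
  simp only [window, mem_ofPred_eq]
  exact ⟨fun hx => ⟨hx.1.1, hx.2⟩, fun hx => ⟨⟨hx.1, hx.2.1, hx.2.2.trans h⟩, hx.2⟩⟩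

/-- The next spine individual is born at time `A`, so times up to `σ` see her subtree only up to `σ
- A`. This loss of window length drives the induction in `tendsto_excess`. -/
lemma window_stepTree (q : StepData) (σ : ℝ) (T : Tree) :
    window σ (stepTree q T) = window σ (stepTree q (window (σ - q.1.1.1) T)) := by
  ext x
  have h := congrArg (x ∈ ·)
    (window_graftAt (daughterLabel (stepAges q) q.1.1.1) q.1.1.1 σ T)
  simp only [window, stepTree, mem_ofPred_eq] at h ⊢
  simp only [eq_iff_iff] at h
  tauto

lemma window_stepSpine (q : StepData) (σ : ℝ) (B : Tree) :
    window σ (stepSpine q B) = window σ (stepSpine q (window (σ - q.1.1.1) B)) := by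
  ext x
  have h := congrArg (x ∈ ·)
    (window_graftAt (daughterLabel (stepAges q) q.1.1.1) q.1.1.1 σ B)
  simp only [window, stepSpine, mem_ofPred_eq] at h ⊢
  simp only [eq_iff_iff] at h
  tauto

/-! ### The limiting tree -/

/-- The data of the first individual of the spine. -/
def headData (ξ : LimitData) : StepData := (ξ.1 0, ξ.2 0)

/-- The data of the tree that descends from the second individual of the spine. -/
def shiftData (ξ : LimitData) : LimitData := (fun k => ξ.1 (k + 1), fun k => ξ.2 (k + 1))

lemma measurePreserving_prod_comm_middle {α β γ δ : Type*} [MeasurableSpace α]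
    [MeasurableSpace β] [MeasurableSpace γ] [MeasurableSpace δ] (μ : Measure α) (ν : Measure β)
    (τ : Measure γ) (ρ : Measure δ) [SFinite μ] [SFinite ν] [SFinite τ] [SFinite ρ] :
    MeasurePreserving (fun p : (α × β) × (γ × δ) => ((p.1.1, p.2.1), (p.1.2, p.2.2)))
      ((μ.prod ν).prod (τ.prod ρ)) ((μ.prod τ).prod (ν.prod ρ)) := by
  have h1 := measurePreserving_prodAssoc μ ν (τ.prod ρ)
  have h2 := (measurePreserving_prodAssoc ν τ ρ).symm
  have h3 : MeasurePreserving (Prod.map (Prod.swap : β × γ → γ × β) (id : δ → δ))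
      ((ν.prod τ).prod ρ) ((τ.prod ν).prod ρ) :=
    Measure.measurePreserving_swap.prod (MeasurePreserving.id ρ)
  have h4 := measurePreserving_prodAssoc τ ν ρ
  have h5 := (measurePreserving_prodAssoc μ τ (ν.prod ρ)).symm
  exact h5.comp (((MeasurePreserving.id μ).prod (h4.comp (h3.comp h2))).comp h1)

section Laws

lemma limitLaw_eq (Λ : Measure ℝ) : limitLaw Λ = (Measure.infinitePi fun _ : ℕ => stepConfigLaw Λ).prod
    (Measure.infinitePi fun _ : ℕ => Measure.infinitePi fun _ : ℕ => splittingLaw Λ) := rfl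

variable (Λ : Measure ℝ) [IsFiniteMeasure Λ] [NeZero Λ] [IsProbabilityMeasure (sizeBiased Λ)]

instance : IsProbabilityMeasure (limitLaw Λ) := by rw [limitLaw_eq]; infer_instance

/-- The limiting tree is regenerated at the birth of the second individual of the spine. -/
lemma measurePreserving_head_shift :
    MeasurePreserving (fun ξ => (headData ξ, shiftData ξ)) (limitLaw Λ)
      ((stepDataLaw Λ).prod (limitLaw Λ)) := by
  have h1 := (measurePreserving_head_tail (stepConfigLaw Λ)).prod (measurePreserving_head_tail
    (Measure.infinitePi fun _ : ℕ => splittingLaw Λ))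
  exact (measurePreserving_prod_comm_middle _ _ _ _).comp h1

end Laws

lemma spineLabel_succ (ξ : LimitData) (k : ℕ) : spineLabel ξ (k + 1) =
    daughterLabel (stepAges (headData ξ)) (headData ξ).1.1.1 :: spineLabel (shiftData ξ) k := by
  induction k with
  | zero => rfl
  | succ k ih =>
    rw [spineLabel, ih]
    rfl

lemma spineBirth_succ (ξ : LimitData) (k : ℕ) : spineBirth (spineSteps ξ) (k + 1) =
    (headData ξ).1.1.1 + spineBirth (spineSteps (shiftData ξ)) k := by
  rw [spineBirth, Finset.sum_range_succ', add_comm]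
  rfl

/-- The almost sure properties of the data of the limiting tree. -/
structure GoodLimit (ξ : LimitData) : Prop where
  age_pos : ∀ k, 0 < (spineSteps ξ k).1
  residual_pos : ∀ k, 0 < (spineSteps ξ k).2
  config : ∀ k, GoodConfig (ξ.1 k).2
  lives : ∀ k i, GoodLives (ξ.2 k i)
  graftAge_ne : ∀ k i, graftAge ξ k i ≠ (spineSteps ξ k).1
  extinct : ∀ k i, ∃ n, ¬ Reach n (ξ.2 k i)

namespace GoodLimit

variable {ξ : LimitData} (h : GoodLimit ξ)
include h

lemma shift : GoodLimit (shiftData ξ) :=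
  ⟨fun _ => h.age_pos _, fun _ => h.residual_pos _, fun _ => h.config _, fun _ _ => h.lives _ _,
    fun _ _ => h.graftAge_ne _ _, fun _ _ => h.extinct _ _⟩

lemma graftAge_pos (k i : ℕ) : 0 < graftAge ξ k i :=
  mul_pos (add_pos (h.age_pos k) (h.residual_pos k)) ((h.config k).1 i).1

lemma spineBirth_nonneg (k : ℕ) : 0 ≤ spineBirth (spineSteps ξ) k :=
  Finset.sum_nonneg fun i _ => (h.age_pos i).le

lemma posPart_limitSpine :
    posPart (limitSpine ξ) = stepSpine (headData ξ) (limitSpine (shiftData ξ)) := by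
  ext ⟨u, s⟩
  simp only [posPart, stepSpine, mem_ofPred_eq, mem_graftAt_singleton]
  simp only [limitSpine, rootSegment, mem_ofPred_eq]
  constructor
  · rintro ⟨⟨k, rfl, hk⟩, hs⟩
    have hs' : 0 < s := hs
    cases k with
    | zero =>
      rcases hk with ⟨_, rfl⟩ | ⟨_, hk⟩
      · exact absurd hs' (lt_irrefl _)
      · exact Or.inl ⟨rfl, hs, by simpa [spineBirth, spineSteps, headData] using hk⟩
    | succ k =>
      rcases hk with ⟨hk, _⟩ | ⟨hk, hk'⟩
      · simp at hk
      · rw [spineBirth_succ] at hk hk'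
        have := h.shift.spineBirth_nonneg k
        refine Or.inr ⟨_, spineLabel_succ ξ k, by linarith, k, rfl, Or.inr ⟨by linarith, ?_⟩⟩
        change s - _ ≤ spineBirth (spineSteps (shiftData ξ)) k + (spineSteps ξ (k + 1)).1 +
          (spineSteps ξ (k + 1)).2
        linarith
  · rintro (⟨rfl, hs, hz⟩ | ⟨w, rfl, hs, k, rfl, hk⟩)
    · exact ⟨⟨0, rfl, Or.inr ⟨by simpa [spineBirth] using hs,
        by simpa [spineBirth, spineSteps, headData] using hz⟩⟩, hs⟩
    · have hA : 0 < (headData ξ).1.1.1 := h.age_pos 0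
      refine ⟨⟨k + 1, (spineLabel_succ ξ k).symm, Or.inr ?_⟩, by linarith⟩
      rw [spineBirth_succ]
      rcases hk with ⟨_, hk⟩ | ⟨hk, hk'⟩
      -- The origin of the shifted spine would sit at time `s - A = 0`, which grafting discards.
      · exact absurd hk hs.ne'
      · change s - _ ≤ spineBirth (spineSteps (shiftData ξ)) k + (spineSteps ξ (k + 1)).1 +
          (spineSteps ξ (k + 1)).2 at hk'
        exact ⟨by linarith, by linarith⟩

omit h in
-- With `0 ≤ b` the points of the inner graft have positive times, so the outer graft loses none of
-- them.
lemma graftAt_cons_label {l : ℕ+} {v : Label} {a b : ℝ} (hb : 0 ≤ b) {T : Tree} :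
    graftAt (l :: v) (a + b) T = graftAt [l] a (graftAt v b T) := by
  ext ⟨u, s⟩
  rw [mem_graftAt_singleton]
  constructor
  · rintro ⟨w, τ, hw, hτ, hx⟩
    obtain ⟨rfl, rfl⟩ := Prod.ext_iff.1 hx
    exact ⟨v ++ w, rfl, by change 0 < a + b + τ - a; linarith,
      w, τ, hw, hτ, Prod.ext rfl (by change a + b + τ - a = b + τ; ring)⟩
  · rintro ⟨_, rfl, _, w, τ, hw, hτ, hx⟩
    obtain ⟨rfl, hs⟩ := Prod.ext_iff.1 hx
    have hs' : s - a = b + τ := hs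
    exact ⟨w, τ, hw, hτ, Prod.ext rfl (by change s = a + b + τ; linarith)⟩

omit h in
lemma mem_limitTree {x : Label × ℝ} : x ∈ limitTree ξ ↔ x ∈ limitSpine ξ ∨
    ∃ k i, i < (ξ.1 k).2.1 ∧
      x ∈ graftAt (spineLabel ξ k ++ [daughterLabel (spineBirthAges ξ k) (graftAge ξ k i)])
        (spineBirth (spineSteps ξ) k + graftAge ξ k i) (tree (ξ.2 k i)) := by
  simp [limitTree]

omit h in
lemma mem_graftAt_pos {u : Label} {a s : ℝ} {v : Label} {T : Tree} (ha : 0 ≤ a)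
    (hx : (v, s) ∈ graftAt u a T) : 0 < s := by
  obtain ⟨w, τ, _, hτ, hx⟩ := hx
  obtain rfl : s = a + τ := (Prod.ext_iff.1 hx).2
  exact add_pos_of_nonneg_of_pos ha hτ

/-- Grafts on the first spine individual are those of `stepTree`; grafts on individual `k + 1` are
the grafts on individual `k` of the shifted tree, carried along when that tree is grafted at age
`A`. -/
lemma posPart_limitTree :
    posPart (limitTree ξ) = stepTree (headData ξ) (limitTree (shiftData ξ)) := by
  have hA : 0 < (headData ξ).1.1.1 := h.age_pos 0
  ext ⟨u, s⟩
  have hsp : (u, s) ∈ posPart (limitSpine ξ) ↔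
      (u, s) ∈ stepSpine (headData ξ) (limitSpine (shiftData ξ)) := by rw [h.posPart_limitSpine]
  have hgr : ∀ k i, graftAt (spineLabel ξ (k + 1) ++
      [daughterLabel (spineBirthAges ξ (k + 1)) (graftAge ξ (k + 1) i)])
      (spineBirth (spineSteps ξ) (k + 1) + graftAge ξ (k + 1) i) (tree (ξ.2 (k + 1) i)) =
      graftAt [daughterLabel (stepAges (headData ξ)) (headData ξ).1.1.1] (headData ξ).1.1.1
        (graftAt (spineLabel (shiftData ξ) k ++ [daughterLabel (spineBirthAges (shiftData ξ) k)
          (graftAge (shiftData ξ) k i)]) (spineBirth (spineSteps (shiftData ξ)) k +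
            graftAge (shiftData ξ) k i) (tree ((shiftData ξ).2 k i))) := fun k i => by
    rw [spineLabel_succ, spineBirth_succ, List.cons_append, add_assoc]
    exact graftAt_cons_label
      (add_nonneg (h.shift.spineBirth_nonneg k) (h.shift.graftAge_pos k i).le)
  have hroot : ∀ i, graftAt (spineLabel ξ 0 ++
      [daughterLabel (spineBirthAges ξ 0) (graftAge ξ 0 i)])
      (spineBirth (spineSteps ξ) 0 + graftAge ξ 0 i) (tree (ξ.2 0 i)) =
      graftAt [daughterLabel (stepAges (headData ξ))
        (((headData ξ).1.1.1 + (headData ξ).1.1.2) * (headData ξ).1.2.2 i)]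
        (((headData ξ).1.1.1 + (headData ξ).1.1.2) * (headData ξ).1.2.2 i)
        (tree ((headData ξ).2 i)) := fun i => by
    have : spineBirth (spineSteps ξ) 0 = 0 := by simp [spineBirth]
    rw [this, zero_add]
    rfl
  constructor
  · rintro ⟨hx, hs⟩
    rcases mem_limitTree.1 hx with hx | ⟨k, i, hi, hx⟩
    · rcases hsp.1 ⟨hx, hs⟩ with hx | hx
      · exact Or.inl hx
      · obtain ⟨w, rfl, hs', hw⟩ := mem_graftAt_singleton.1 hx
        exact Or.inr (Or.inl (mem_graftAt_singleton.2
          ⟨w, rfl, hs', mem_limitTree.2 (Or.inl hw)⟩))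
    · cases k with
      | zero => rw [hroot] at hx; exact Or.inr (Or.inr ⟨i, hi, hx⟩)
      | succ k =>
        rw [hgr] at hx
        obtain ⟨w, rfl, hs', hw⟩ := mem_graftAt_singleton.1 hx
        exact Or.inr (Or.inl (mem_graftAt_singleton.2
          ⟨w, rfl, hs', mem_limitTree.2 (Or.inr ⟨k, i, hi, hw⟩)⟩))
  · rintro (hx | hx | ⟨i, hi, hx⟩)
    · have := hsp.2 (Or.inl hx)
      exact ⟨mem_limitTree.2 (Or.inl this.1), this.2⟩
    · obtain ⟨w, rfl, hs, hw⟩ := mem_graftAt_singleton.1 hx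
      rcases mem_limitTree.1 hw with hw | ⟨k, i, hi, hw⟩
      · have := hsp.2 (Or.inr (mem_graftAt_singleton.2 ⟨w, rfl, hs, hw⟩))
        exact ⟨mem_limitTree.2 (Or.inl this.1), this.2⟩
      · have hx' := (mem_graftAt_singleton
          (l := daughterLabel (stepAges (headData ξ)) (headData ξ).1.1.1)).2 ⟨w, rfl, hs, hw⟩
        rw [← hgr] at hx'
        exact ⟨mem_limitTree.2 (Or.inr ⟨k + 1, i, hi, hx'⟩), mem_graftAt_pos
          (add_nonneg (h.spineBirth_nonneg _) (h.graftAge_pos _ _).le) hx'⟩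
    · rw [← hroot] at hx
      exact ⟨mem_limitTree.2 (Or.inr ⟨0, i, hi, hx⟩), mem_graftAt_pos
          (add_nonneg (h.spineBirth_nonneg _) (h.graftAge_pos _ _).le) hx⟩

/-! ### Truncations of the limiting tree -/

omit h in
lemma root_mem_limitSpine : (([] : Label), (0 : ℝ)) ∈ limitSpine ξ :=
  ⟨0, rfl, Or.inl ⟨rfl, rfl⟩⟩

lemma eq_root_of_mem_limitSpine {x : Label × ℝ} (hx : x ∈ limitSpine ξ) (hs : x.2 ≤ 0) :
    x = ([], 0) := by
  obtain ⟨k, hk, ⟨rfl, h0⟩ | ⟨h1, _⟩⟩ := hx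
  · exact Prod.ext hk h0
  · have := h.spineBirth_nonneg k
    linarith

lemma eq_root_of_mem_limitTree {x : Label × ℝ} (hx : x ∈ limitTree ξ) (hs : x.2 ≤ 0) :
    x = ([], 0) := by
  rcases mem_limitTree.1 hx with hx | ⟨k, i, hi, hx⟩
  · exact h.eq_root_of_mem_limitSpine hx hs
  · exact absurd hs (not_le.2 (mem_graftAt_pos
      (add_nonneg (h.spineBirth_nonneg _) (h.graftAge_pos _ _).le) hx))

lemma trunc_limitSpine {σ : ℝ} (hσ : 0 < σ) :
    trunc σ (limitSpine ξ) = insert ([], 0) (window σ (limitSpine ξ)) :=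
  trunc_eq_of_root root_mem_limitSpine (fun _ => h.eq_root_of_mem_limitSpine) hσ

lemma trunc_limitTree {σ : ℝ} (hσ : 0 < σ) :
    trunc σ (limitTree ξ) = insert ([], 0) (window σ (limitTree ξ)) :=
  trunc_eq_of_root (mem_limitTree.2 (Or.inl root_mem_limitSpine))
    (fun _ => h.eq_root_of_mem_limitTree) hσ

end GoodLimit

/-! ### Measurability of the limiting tree -/

lemma measurable_spineSteps (k : ℕ) : Measurable fun ξ : LimitData => spineSteps ξ k := by
  unfold spineSteps; fun_prop

lemma measurable_graftAge (k i : ℕ) : Measurable fun ξ : LimitData => graftAge ξ k i := by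
  unfold graftAge spineSteps; fun_prop

lemma measurable_spineBirthAges (k : ℕ) :
    MeasurableFinset fun ξ : LimitData => spineBirthAges ξ k :=
  (MeasurableFinset.points (by unfold spineSteps; fun_prop) (by fun_prop)).insert
    (measurable_spineSteps k).fst

lemma measurable_spineLabel_eq (k : ℕ) (u : Label) :
    Measurable fun ξ : LimitData => spineLabel ξ k = u := by
  induction k generalizing u with
  | zero => exact measurable_const (a := [] = u)
  | succ k ih =>
    have : (fun ξ : LimitData => spineLabel ξ (k + 1) = u) = fun ξ => ∃ v : Label,
        spineLabel ξ k = v ∧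
          v ++ [daughterLabel (spineBirthAges ξ k) (spineSteps ξ k).1] = u := by
      funext ξ; simp [spineLabel]
    rw [this]
    exact Measurable.exists fun v => (ih v).and
      ((Measurable.of_discrete (f := fun j : ℕ+ => v ++ [j] = u)).comp
        ((measurable_spineBirthAges k).daughterLabel (measurable_spineSteps k).fst))

lemma measurable_spineBirth (k : ℕ) :
    Measurable fun ξ : LimitData => spineBirth (spineSteps ξ) k :=
  Finset.measurable_fun_sum _ fun i _ => (measurable_spineSteps i).fst

lemma measurableTree_limitSpine : MeasurableTree limitSpine := by
  intro u
  have hb : ∀ k, Measurable fun p : LimitData × ℝ => spineBirth (spineSteps p.1) k := fun k =>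
    (measurable_spineBirth k).comp measurable_fst
  have hs : ∀ k, Measurable fun p : LimitData × ℝ => spineSteps p.1 k := fun k =>
    (measurable_spineSteps k).comp measurable_fst
  refine Measurable.exists fun k => Measurable.and ?_ (Measurable.or ?_ ?_)
  · simp only [eq_comm (a := u)]
    exact (measurable_spineLabel_eq k u).comp measurable_fst
  · exact measurable_const.and (measurable_snd.eq_const 0)
  · exact (measurable_lt_prop (hb k) measurable_snd).and (measurable_le_prop measurable_snd
      (((hb k).add (hs k).fst).add (hs k).snd))

lemma measurableTree_limitTree : MeasurableTree limitTree := by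
  intro u
  simp only [GoodLimit.mem_limitTree]
  refine (measurableTree_limitSpine u).or (Measurable.exists fun k => Measurable.exists fun i =>
    Measurable.and (measurable_natLt_prop i (by fun_prop)) ?_)
  have : (fun p : LimitData × ℝ => (u, p.2) ∈ graftAt
      (spineLabel p.1 k ++ [daughterLabel (spineBirthAges p.1 k) (graftAge p.1 k i)])
      (spineBirth (spineSteps p.1) k + graftAge p.1 k i) (tree (p.1.2 k i))) = fun p =>
      ∃ v : Label, spineLabel p.1 k = v ∧ ∃ w : Label,
        v ++ [daughterLabel (spineBirthAges p.1 k) (graftAge p.1 k i)] ++ w = u ∧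
        0 < p.2 - (spineBirth (spineSteps p.1) k + graftAge p.1 k i) ∧
        (w, p.2 - (spineBirth (spineSteps p.1) k + graftAge p.1 k i)) ∈ tree (p.1.2 k i) := by
    funext p
    refine propext ⟨?_, ?_⟩
    · rintro ⟨w, τ, hw, hτ, hx⟩
      obtain ⟨h1, h2⟩ := Prod.ext_iff.1 hx
      have h2' : p.2 - (spineBirth (spineSteps p.1) k + graftAge p.1 k i) = τ := by
        have : p.2 = _ := h2
        rw [this]; simp
      exact ⟨_, rfl, w, h1.symm, h2'.symm ▸ hτ, h2'.symm ▸ hw⟩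
    · rintro ⟨_, rfl, w, hw, hτ, h⟩
      exact ⟨w, _, h, hτ, Prod.ext hw.symm (by simp)⟩
  rw [this]
  have ht : Measurable fun p : LimitData × ℝ =>
      p.2 - (spineBirth (spineSteps p.1) k + graftAge p.1 k i) :=
    measurable_snd.sub
      (((measurable_spineBirth k).add (measurable_graftAge k i)).comp measurable_fst)
  refine Measurable.exists fun v => ((measurable_spineLabel_eq k v).comp measurable_fst).and
    (Measurable.exists fun w => Measurable.and ?_ (Measurable.and ?_ ?_))
  · exact (Measurable.of_discrete (f := fun j : ℕ+ => v ++ [j] ++ w = u)).comp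
      (((measurable_spineBirthAges k).daughterLabel (measurable_graftAge k i)).comp
        measurable_fst)
  · exact measurable_lt_prop measurable_const ht
  · exact (measurableTree_tree w).comp
      (f := fun p : LimitData × ℝ => (p.1.2 k i, p.2 - (spineBirth (spineSteps p.1) k +
        graftAge p.1 k i))) (Measurable.prodMk (by fun_prop) ht)

/-! ### The spinal decomposition of the conditioned tree -/

lemma exists_mem_of_ae {α : Type*} [MeasurableSpace α] {μ : Measure α} {p : α → Prop} {s : Set α}
    (h : ∀ᵐ x ∂μ, p x) (hs : μ s ≠ 0) : ∃ x ∈ s, p x := by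
  obtain ⟨x, hx, hp⟩ := ((frequently_ae_mem_iff.2 hs).and_eventually h).exists
  exact ⟨x, hx, hp⟩

section Laws

variable (Λ : Measure ℝ) [IsFiniteMeasure Λ] [NeZero Λ]

/-- The probability of having individuals at generation `n`. -/
noncomputable def survival (n : ℕ) : ℝ≥0∞ := splittingLaw Λ {d | Reach n d}

/-- The probability that no tree grafted to the right of the first individual of the spine reaches
generation `n`. -/
noncomputable def noRightProb (n : ℕ) : ℝ≥0∞ := stepDataLaw Λ {q | NoRight n q}

omit [IsFiniteMeasure Λ] [NeZero Λ] in
lemma measurableSet_spinal (n : ℕ) {S : Set (Tree × Tree)} (hS : MeasurableSet S) :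
    MeasurableSet {p : StepData × (Label → Life) | NoRight n p.1 ∧ Reach n p.2 ∧
      (stepTree p.1 (tree p.2), stepSpine p.1 (lineage n p.2)) ∈ S} := by
  refine measurableSet_setOfPred.2 (Measurable.and ?_ (Measurable.and ?_ ?_))
  · exact (measurable_noRight n).comp measurable_fst
  · exact (measurable_reach n).comp measurable_snd
  · exact measurableSet_setOfPred.1 (hS.preimage
      (((measurableTree_tree.comp measurable_snd).stepTree measurable_fst).measurable.prodMk
        (((measurableTree_lineage n).comp measurable_snd).stepSpine measurable_fst).measurable))

open scoped Classical in
-- Exactly one daughter starts the first lineage when generation `n + 1` is reached, and none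
-- otherwise; hence the sum over daughters is itself an indicator.
lemma sum_spineView_eq {n : ℕ} {d : Label → Life} (hd : GoodLives d) (S : Set (Tree × Tree)) :
    ∑ i ∈ Finset.range (d []).2.1,
      {p : StepData × (Label → Life) | NoRight n p.1 ∧ Reach n p.2 ∧
        (stepTree p.1 (tree p.2), stepSpine p.1 (lineage n p.2)) ∈ S}.indicator
        (fun _ => (1 : ℝ≥0∞)) (spineView (d []) (offspring d) i) =
    {d | Reach (n + 1) d ∧ (posPart (tree d), lineage (n + 1) d) ∈ S}.indicator (fun _ => 1) d := by
  have key : ∀ i < (d []).2.1, spineView (d []) (offspring d) i ∈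
      {p : StepData × (Label → Life) | NoRight n p.1 ∧ Reach n p.2 ∧
        (stepTree p.1 (tree p.2), stepSpine p.1 (lineage n p.2)) ∈ S} ↔
      IsFirst n d i ∧ (posPart (tree d), lineage (n + 1) d) ∈ S := fun i hi => by
    constructor
    · rintro ⟨h1, h2, h3⟩
      have hf := (isFirst_iff hi).2 ⟨h2, h1⟩
      refine ⟨hf, ?_⟩
      rwa [posPart_tree_eq_stepTree hd hi, lineage_succ_eq_stepSpine hd hi hf]
    · rintro ⟨hf, h⟩
      obtain ⟨h1, h2⟩ := (isFirst_iff hi).1 hf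
      rw [posPart_tree_eq_stepTree hd hi, lineage_succ_eq_stepSpine hd hi hf] at h
      exact ⟨h2, h1, h⟩
  by_cases hr : Reach (n + 1) d
  · obtain ⟨i, hi, hf⟩ := exists_isFirst hr
    rw [Finset.sum_eq_single i]
    · simp only [indicator_apply, key i hi]
      simp [hf, hr]
    · intro j hj hji
      rw [Finset.mem_range] at hj
      refine indicator_of_notMem (fun h => ?_) _
      exact hji (((key j hj).1 h).1.unique hd hj hi hf)
    · intro h; exact absurd (Finset.mem_range.2 hi) h
  · rw [indicator_of_notMem (fun h => hr h.1)]
    refine Finset.sum_eq_zero fun i hi => ?_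
    rw [Finset.mem_range] at hi
    exact indicator_of_notMem (fun h => hr ⟨i, hi, ((key i hi).1 h).1.1⟩) _

variable [IsProbabilityMeasure (sizeBiased Λ)]

lemma measure_reach_succ (h0 : Λ (Iic 0) = 0) (hm0 : meanOffspring Λ ≠ 0)
    (hm1 : meanOffspring Λ ≠ ∞) (n : ℕ) {S : Set (Tree × Tree)} (hS : MeasurableSet S) :
    splittingLaw Λ {d | Reach (n + 1) d ∧ (posPart (tree d), lineage (n + 1) d) ∈ S} =
      meanOffspring Λ * ∫⁻ q in {q | NoRight n q}, splittingLaw Λ {d | Reach n d ∧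
        (stepTree q (tree d), stepSpine q (lineage n d)) ∈ S} ∂(stepDataLaw Λ) := by
  have hE := measurableSet_spinal n hS
  have hp : Measurable posPart := measurable_set_iff.2 fun x =>
    (measurable_set_mem x).and measurable_const
  have hE' : MeasurableSet
      {d | Reach (n + 1) d ∧ (posPart (tree d), lineage (n + 1) d) ∈ S} :=
    (measurableSet_reach (n + 1)).inter (hS.preimage
      ((hp.comp measurableTree_tree.measurable).prodMk (measurableTree_lineage _).measurable))
  have h := many_to_one Λ h0 hm0 hm1 ((measurable_const (a := (1 : ℝ≥0∞))).indicator hE)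
  rw [lintegral_congr_ae (by
    filter_upwards [ae_goodLives Λ h0] with d hd using sum_spineView_eq hd S)] at h
  have h1 : ∫⁻ d, {d | Reach (n + 1) d ∧ (posPart (tree d), lineage (n + 1) d) ∈ S}.indicator
      (fun _ => (1 : ℝ≥0∞)) d ∂(splittingLaw Λ) = splittingLaw Λ
        {d | Reach (n + 1) d ∧ (posPart (tree d), lineage (n + 1) d) ∈ S} :=
    lintegral_indicator_one hE'
  rw [← h1, h, ← lintegral_indicator (measurableSet_setOfPred.2 (measurable_noRight n))]
  congr 1
  refine lintegral_congr fun q => ?_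
  have h2 : MeasurableSet (Prod.mk q ⁻¹' {p : StepData × (Label → Life) | NoRight n p.1 ∧
      Reach n p.2 ∧ (stepTree p.1 (tree p.2), stepSpine p.1 (lineage n p.2)) ∈ S}) :=
    measurable_prodMk_left hE
  refine (lintegral_indicator_one h2).trans ?_
  by_cases hq : NoRight n q
  · rw [indicator_of_mem (by exact hq)]
    congr 1
    ext d
    simp [hq]
  · rw [indicator_of_notMem (by exact hq)]
    have : (Prod.mk q ⁻¹' {p : StepData × (Label → Life) | NoRight n p.1 ∧
      Reach n p.2 ∧ (stepTree p.1 (tree p.2), stepSpine p.1 (lineage n p.2)) ∈ S}) = ∅ := by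
      ext d
      simp [hq]
    rw [this, measure_empty]

lemma survival_succ (h0 : Λ (Iic 0) = 0) (hm0 : meanOffspring Λ ≠ 0)
    (hm1 : meanOffspring Λ ≠ ∞) (n : ℕ) :
    survival Λ (n + 1) = meanOffspring Λ * (noRightProb Λ n * survival Λ n) := by
  have h := measure_reach_succ Λ h0 hm0 hm1 n MeasurableSet.univ
  simp only [mem_univ, and_true, setLIntegral_const] at h
  rw [survival, h, mul_comm (noRightProb Λ n)]
  rfl

/-! ### Extinction -/

omit [IsFiniteMeasure Λ] [NeZero Λ] [IsProbabilityMeasure (sizeBiased Λ)] in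
lemma ae_pos_sizeBiased (h0 : Λ (Iic 0) = 0) : ∀ᵐ z ∂(sizeBiased Λ), 0 < z := by
  have h : ∀ᵐ z ∂Λ, 0 < z := by simp only [ae_iff, not_lt]; exact h0
  exact Measure.ae_smul_measure ((withDensity_absolutelyContinuous Λ _).ae_le h) _

/-- If `E` were null, almost every choice of the uniform variable, the lifetime, the number of
points and their positions would avoid it. Such a choice exists inside the prescribed sets, since a
Poisson law with parameter `b * z > 0` charges every `n`. -/
lemma stepConfigLaw_ne_zero (h0 : Λ (Iic 0) = 0) {E : Set ((ℝ × ℝ) × Config)} (n : ℕ)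
    {s : Set ℝ} {t : Set (ℕ → ℝ)} (hs : unif s ≠ 0)
    (ht : (Measure.infinitePi fun _ : ℕ => unif) t ≠ 0)
    (hE : ∀ z > 0, ∀ u ∈ s, ∀ f ∈ t, ((u * z, (1 - u) * z), (n, f)) ∈ E) :
    stepConfigLaw Λ E ≠ 0 := by
  intro hnull
  have h1 : ∀ᵐ q ∂(stepConfigLaw Λ), q ∉ E := measure_eq_zero_iff_ae_notMem.1 hnull
  have h2 := ae_of_ae_map (by fun_prop) (Measure.ae_ae_of_ae_compProd h1)
  obtain ⟨u, hu, h3⟩ := exists_mem_of_ae (Measure.ae_ae_of_ae_prod h2) hs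
  obtain ⟨z, h4, hz⟩ := (h3.and (ae_pos_sizeBiased Λ h0)).exists
  have huz : u * z + (1 - u) * z = z := by ring
  simp only [Kernel.comap_apply, huz, poissonKernel_apply] at h4
  have hb : 0 < birthRate Λ * z.toNNReal := by
    refine mul_pos ?_ (Real.toNNReal_pos.2 hz)
    exact ENNReal.toNNReal_pos (NeZero.ne (Λ univ)) (measure_ne_top _ _)
  have hn : poissonMeasure (birthRate Λ * z.toNNReal) {n} ≠ 0 := fun h => by
    have := poissonMeasure_real_singleton_pos n hb
    rw [measureReal_def, h] at this
    simp at this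
  obtain ⟨_, rfl, h5⟩ := exists_mem_of_ae (Measure.ae_ae_of_ae_prod h4) hn
  obtain ⟨f, hf, h6⟩ := exists_mem_of_ae h5 ht
  exact h6 (hE z hz u hu f hf)

/-- With positive probability there is no grafting point at all. -/
lemma noRightProb_ne_zero (h0 : Λ (Iic 0) = 0) (n : ℕ) : noRightProb Λ n ≠ 0 := by
  have h := stepConfigLaw_ne_zero Λ h0 (E := {q | q.2.1 = 0}) 0 (s := univ) (t := univ)
    (by simp) (by simp) fun _ _ _ _ _ _ => rfl
  intro hz
  refine h ?_
  have h1 : stepDataLaw Λ ({q : (ℝ × ℝ) × Config | q.2.1 = 0} ×ˢ univ) = 0 := by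
    refine measure_mono_null (t := {q : StepData | NoRight n q}) (fun q hq k hk => ?_) hz
    have : q.1.2.1 = 0 := hq.1
    omega
  rwa [stepDataLaw, Measure.prod_prod, measure_univ, mul_one] at h1

lemma unif_Iio_half : unif (Iio (1 / 2)) ≠ 0 := by
  rw [unif, Measure.restrict_apply measurableSet_Iio, Iio_inter_Ioo, Real.volume_Ioo]
  norm_num

lemma unif_Ioi_half : unif (Ioi (1 / 2)) ≠ 0 := by
  rw [unif, Measure.restrict_apply measurableSet_Ioi, Ioi_inter_Ioo, Real.volume_Ioo]
  norm_num

/-- The event that the first grafting point lies to the right of the spine. -/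
def rightGraft : Set ((ℝ × ℝ) × Config) :=
  {q | 0 < q.2.1 ∧ q.1.1 < (q.1.1 + q.1.2) * q.2.2 0}

lemma rightGraft_ne_zero (h0 : Λ (Iic 0) = 0) : stepConfigLaw Λ rightGraft ≠ 0 := by
  refine stepConfigLaw_ne_zero Λ h0 1 (t := {f | f 0 ∈ Ioi (1 / 2)}) unif_Iio_half ?_ ?_
  · have h := (measurePreserving_eval_infinitePi (fun _ : ℕ => unif) 0).measure_preimage
      (s := Ioi (1 / 2)) measurableSet_Ioi.nullMeasurableSet
    exact fun h' => unif_Ioi_half (h.symm.trans h')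
  · intro z hz u hu f hf
    refine ⟨one_pos, ?_⟩
    change u * z < (u * z + (1 - u) * z) * f 0
    have hu' : u < 1 / 2 := hu
    have hf' : 1 / 2 < f 0 := hf
    nlinarith

/-- `NoRight n` excludes that the first graft lies to the right and that its tree reaches generation
`n`, two independent events. -/
lemma noRightProb_add_le (n : ℕ) :
    noRightProb Λ n + stepConfigLaw Λ rightGraft * survival Λ n ≤ 1 := by
  have hR : MeasurableSet rightGraft := by
    refine measurableSet_setOfPred.2 (Measurable.and ?_ ?_)
    · exact measurable_natLt_prop 0 (by fun_prop)
    · exact measurable_lt_prop (by fun_prop) (by fun_prop)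
  have hS : MeasurableSet {e : ℕ → Label → Life | Reach n (e 0)} :=
    measurableSet_setOfPred.2 ((measurable_reach n).comp (measurable_pi_apply 0))
  have h1 : survival Λ n =
      (Measure.infinitePi fun _ : ℕ => splittingLaw Λ) {e | Reach n (e 0)} :=
    ((measurePreserving_eval_infinitePi (fun _ : ℕ => splittingLaw Λ) 0).measure_preimage
      (measurableSet_reach n).nullMeasurableSet).symm
  rw [h1, ← Measure.prod_prod]
  change stepDataLaw Λ _ + stepDataLaw Λ _ ≤ 1
  rw [← measure_union _ (hR.prod hS)]
  · exact prob_le_one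
  · rw [Set.disjoint_left]
    rintro q hq ⟨h2, h3⟩
    exact hq 0 h2.1 h2.2 h3

omit [IsFiniteMeasure Λ] [NeZero Λ] [IsProbabilityMeasure (sizeBiased Λ)] in
lemma antitone_survival : Antitone (survival Λ) := fun _ _ h =>
  measure_mono fun _ hd => Reach.anti h hd

/-- The quadratic loss `κ * p n ^ 2` passes to the limit `L` of the decreasing sequence `p n` and
gives `κ * L ^ 2 = 0`. This treats the subcritical and critical cases together. -/
lemma tendsto_survival (h0 : Λ (Iic 0) = 0) (hm0 : meanOffspring Λ ≠ 0)
    (hm1 : meanOffspring Λ ≤ 1) : Tendsto (survival Λ) atTop (𝓝 0) := by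
  have hlim := tendsto_atTop_iInf (antitone_survival Λ)
  set L := ⨅ n, survival Λ n with hL
  have hL1 : L ≠ ∞ := ne_top_of_le_ne_top ENNReal.one_ne_top ((iInf_le _ 0).trans prob_le_one)
  set κ := stepConfigLaw Λ rightGraft with hκ
  have hκ1 : κ ≠ ∞ := measure_ne_top _ _
  have hstep : ∀ n, survival Λ (n + 1) + κ * (survival Λ n * survival Λ n) ≤ survival Λ n :=
    fun n => calc
      _ ≤ noRightProb Λ n * survival Λ n + κ * survival Λ n * survival Λ n := by
        rw [survival_succ Λ h0 hm0 (ne_top_of_le_ne_top ENNReal.one_ne_top hm1), mul_assoc κ]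
        exact add_le_add_left (mul_le_of_le_one_left' hm1) _
      _ = (noRightProb Λ n + κ * survival Λ n) * survival Λ n := by rw [add_mul]
      _ ≤ _ := mul_le_of_le_one_left' (noRightProb_add_le Λ n)
  have hlim2 : Tendsto (fun n => survival Λ (n + 1) + κ * (survival Λ n * survival Λ n)) atTop
      (𝓝 (L + κ * (L * L))) :=
    ((tendsto_add_atTop_iff_nat 1).2 hlim).add (ENNReal.Tendsto.const_mul
      (ENNReal.Tendsto.mul hlim (Or.inr hL1) hlim (Or.inr hL1)) (Or.inr hκ1))
  have hle := le_of_tendsto_of_tendsto' hlim2 hlim hstep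
  have hz : κ * (L * L) = 0 := by
    have : L + κ * (L * L) ≤ L + 0 := by simpa using hle
    exact le_antisymm ((ENNReal.add_le_add_iff_left hL1).1 this) zero_le
  have hL0 : L = 0 := by
    rcases mul_eq_zero.1 hz with h | h
    · exact absurd h (rightGraft_ne_zero Λ h0)
    · simpa using h
  rwa [hL0] at hlim

lemma survival_ne_zero (h0 : Λ (Iic 0) = 0) (hm0 : meanOffspring Λ ≠ 0)
    (hm1 : meanOffspring Λ ≤ 1) (n : ℕ) : survival Λ n ≠ 0 := by
  induction n with
  | zero => simp [survival, Reach]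
  | succ n ih =>
    rw [survival_succ Λ h0 hm0 (ne_top_of_le_ne_top ENNReal.one_ne_top hm1)]
    exact mul_ne_zero hm0 (mul_ne_zero (noRightProb_ne_zero Λ h0 n) ih)

lemma ae_extinct (h0 : Λ (Iic 0) = 0) (hm0 : meanOffspring Λ ≠ 0) (hm1 : meanOffspring Λ ≤ 1) :
    ∀ᵐ d ∂(splittingLaw Λ), ∃ n, ¬ Reach n d := by
  rw [ae_iff]
  refine le_antisymm (ge_of_tendsto' (tendsto_survival Λ h0 hm0 hm1) fun n => ?_) zero_le
  exact measure_mono fun d hd => by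
    simp only [not_exists, not_not, mem_ofPred_eq] at hd
    exact hd n

lemma tendsto_noRightProb (h0 : Λ (Iic 0) = 0) (hm0 : meanOffspring Λ ≠ 0)
    (hm1 : meanOffspring Λ ≤ 1) : Tendsto (noRightProb Λ) atTop (𝓝 1) := by
  have hmono : Monotone fun n => {q : StepData | NoRight n q} :=
    fun n m hnm q hq k hk hlt hr => hq k hk hlt (Reach.anti hnm hr)
  have h := tendsto_measure_iUnion_atTop (μ := stepDataLaw Λ) hmono
  have hae : ∀ᵐ q ∂(stepDataLaw Λ), q ∈ ⋃ n, {q : StepData | NoRight n q} := by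
    have h1 : ∀ᵐ q ∂(stepDataLaw Λ), ∀ k, ∃ n, ¬ Reach n (q.2 k) := by
      refine Measure.quasiMeasurePreserving_snd.ae
        (p := fun e : ℕ → Label → Life => ∀ k, ∃ n, ¬ Reach n (e k)) (ae_all_iff.2 fun k => ?_)
      exact (measurePreserving_eval_infinitePi (fun _ : ℕ => splittingLaw Λ)
        k).quasiMeasurePreserving.ae (ae_extinct Λ h0 hm0 hm1)
    filter_upwards [h1] with q hq
    choose N hN using hq
    -- The grafts are finitely many: past the largest of their extinction generations none survives.
    refine mem_iUnion.2 ⟨(Finset.range q.1.2.1).sup N, fun k hk _ hr => hN k ?_⟩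
    exact Reach.anti (Finset.le_sup (Finset.mem_range.2 hk)) hr
  have hU : MeasurableSet (⋃ n, {q : StepData | NoRight n q}) :=
    MeasurableSet.iUnion fun n => measurableSet_setOfPred.2 (measurable_noRight n)
  rwa [(mem_ae_iff_prob_eq_one hU).1 hae] at h

end Laws

/-! ### Convergence of the conditioned tree -/

/-- The restriction of two sets of points to the time window `(0, σ]`. -/
def windowPair (σ : ℝ) (X : Tree × Tree) : Tree × Tree := (window σ X.1, window σ X.2)

lemma measurable_windowPair (σ : ℝ) : Measurable (windowPair σ) :=
  ((measurable_window σ).comp measurable_fst).prodMk ((measurable_window σ).comp measurable_snd)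

/-- The event, for the tree that descends from the second individual of the spine and its spine,
that corresponds to the event `S` for the whole tree and its spine in the window `(0, σ]`. -/
def stepEvent (q : StepData) (σ : ℝ) (S : Set (Tree × Tree)) : Set (Tree × Tree) :=
  {X | windowPair σ (stepTree q X.1, stepSpine q X.2) ∈ S}

lemma measurableSet_stepEvent (q : StepData) (σ : ℝ) {S : Set (Tree × Tree)}
    (hS : MeasurableSet S) : MeasurableSet (stepEvent q σ S) :=
  hS.preimage ((measurable_windowPair σ).comp
    (((measurable_stepTree q).comp measurable_fst).prodMk
      ((measurable_stepSpine q).comp measurable_snd)))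

lemma windowPair_mem_stepEvent {q : StepData} {σ : ℝ} {S : Set (Tree × Tree)} {X : Tree × Tree} :
    windowPair (σ - q.1.1.1) X ∈ stepEvent q σ S ↔
      windowPair σ (stepTree q X.1, stepSpine q X.2) ∈ S := by
  simp only [stepEvent, windowPair, mem_ofPred_eq]
  rw [← window_stepTree, ← window_stepSpine]

section Laws

variable (Λ : Measure ℝ) [IsFiniteMeasure Λ] [NeZero Λ]

/-- The law of the tree and its first lineage reaching generation `n`, conditional on survival. -/
noncomputable def conditionedLaw (n : ℕ) : Measure (Tree × Tree) :=
  ((splittingLaw Λ)[|{d | Reach n d}]).map fun d => (tree d, lineage n d)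

/-- The law of the limiting tree and its spine. -/
noncomputable def limitTreeLaw : Measure (Tree × Tree) :=
  (limitLaw Λ).map fun ξ => (limitTree ξ, limitSpine ξ)

lemma measurable_tree_lineage (n : ℕ) :
    Measurable fun d : Label → Life => (tree d, lineage n d) :=
  measurableTree_tree.measurable.prodMk (measurableTree_lineage n).measurable

lemma measurable_limitTree_limitSpine :
    Measurable fun ξ : LimitData => (limitTree ξ, limitSpine ξ) :=
  measurableTree_limitTree.measurable.prodMk measurableTree_limitSpine.measurable

omit [IsFiniteMeasure Λ] [NeZero Λ] in
lemma conditionedLaw_apply (n : ℕ) {S : Set (Tree × Tree)} (hS : MeasurableSet S) :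
    conditionedLaw Λ n S =
      (survival Λ n)⁻¹ * splittingLaw Λ {d | Reach n d ∧ (tree d, lineage n d) ∈ S} := by
  rw [conditionedLaw, Measure.map_apply (measurable_tree_lineage n) hS,
    cond_apply (measurableSet_reach n)]
  rfl

lemma isProbabilityMeasure_conditionedLaw {n : ℕ} (h : survival Λ n ≠ 0) :
    IsProbabilityMeasure (conditionedLaw Λ n) :=
  have := cond_isProbabilityMeasure (μ := splittingLaw Λ) (s := {d | Reach n d}) h
  Measure.isProbabilityMeasure_map (measurable_tree_lineage n).aemeasurable

variable [IsProbabilityMeasure (sizeBiased Λ)]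

instance : IsProbabilityMeasure (limitTreeLaw Λ) :=
  Measure.isProbabilityMeasure_map measurable_limitTree_limitSpine.aemeasurable

/-- Dividing `measure_reach_succ` by `survival_succ` cancels the mean and the survival probability.
Only the conditioning of the first individual on `NoRight n` remains. -/
lemma conditionedLaw_succ (h0 : Λ (Iic 0) = 0) (hm0 : meanOffspring Λ ≠ 0)
    (hm1 : meanOffspring Λ ≤ 1) (n : ℕ) (σ : ℝ) {S : Set (Tree × Tree)} (hS : MeasurableSet S) :
    conditionedLaw Λ (n + 1) (windowPair σ ⁻¹' S) =
      (noRightProb Λ n)⁻¹ * ∫⁻ q in {q | NoRight n q},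
        conditionedLaw Λ n (windowPair (σ - q.1.1.1) ⁻¹' stepEvent q σ S) ∂(stepDataLaw Λ) := by
  have hm1' : meanOffspring Λ ≠ ∞ := ne_top_of_le_ne_top ENNReal.one_ne_top hm1
  have hp := survival_ne_zero Λ h0 hm0 hm1 n
  have hp' : survival Λ n ≠ ∞ := measure_ne_top _ _
  have hr := noRightProb_ne_zero Λ h0 n
  have hr' : noRightProb Λ n ≠ ∞ := measure_ne_top _ _
  have hW := hS.preimage (measurable_windowPair σ)
  have h1 : {d | Reach (n + 1) d ∧ (tree d, lineage (n + 1) d) ∈ windowPair σ ⁻¹' S} =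
      {d | Reach (n + 1) d ∧ (posPart (tree d), lineage (n + 1) d) ∈ windowPair σ ⁻¹' S} := by
    simp only [mem_preimage, windowPair, window_posPart]
  have h2 : ∀ q, splittingLaw Λ {d | Reach n d ∧
      (stepTree q (tree d), stepSpine q (lineage n d)) ∈ windowPair σ ⁻¹' S} =
      survival Λ n * conditionedLaw Λ n (windowPair (σ - q.1.1.1) ⁻¹' stepEvent q σ S) := by
    intro q
    rw [conditionedLaw_apply Λ n ((measurableSet_stepEvent q σ hS).preimage
      (measurable_windowPair _)), ← mul_assoc, ENNReal.mul_inv_cancel hp hp', one_mul]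
    simp only [mem_preimage, windowPair_mem_stepEvent]
  rw [conditionedLaw_apply Λ _ hW, h1, measure_reach_succ Λ h0 hm0 hm1' n hW]
  simp_rw [h2]
  rw [lintegral_const_mul' _ _ hp', survival_succ Λ h0 hm0 hm1',
    ENNReal.mul_inv (Or.inl hm0) (Or.inl hm1'), ENNReal.mul_inv (Or.inl hr) (Or.inl hr')]
  set I := ∫⁻ q in {q | NoRight n q},
        conditionedLaw Λ n (windowPair (σ - q.1.1.1) ⁻¹' stepEvent q σ S) ∂(stepDataLaw Λ)
  calc _ = ((meanOffspring Λ)⁻¹ * meanOffspring Λ) * ((survival Λ n)⁻¹ * survival Λ n) *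
        ((noRightProb Λ n)⁻¹ * I) := by ring
    _ = _ := by
      rw [ENNReal.inv_mul_cancel hm0 hm1', ENNReal.inv_mul_cancel hp hp', one_mul, one_mul]

/-! ### Almost sure properties and regeneration of the limiting tree -/

omit [IsFiniteMeasure Λ] [NeZero Λ] in
lemma ae_stepConfigLaw (h0 : Λ (Iic 0) = 0) : ∀ᵐ q ∂(stepConfigLaw Λ),
    0 < q.1.1 ∧ 0 < q.1.2 ∧ GoodConfig q.2 ∧ ∀ i, (q.1.1 + q.1.2) * q.2.2 i ≠ q.1.1 := by
  have hm : MeasurableSet {q : (ℝ × ℝ) × Config |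
      0 < q.1.1 ∧ 0 < q.1.2 ∧ GoodConfig q.2 ∧ ∀ i, (q.1.1 + q.1.2) * q.2.2 i ≠ q.1.1} := by
    refine measurableSet_setOfPred.2 (Measurable.and ?_ (Measurable.and ?_ (Measurable.and ?_ ?_)))
    · exact measurable_lt_prop measurable_const (by fun_prop)
    · exact measurable_lt_prop measurable_const (by fun_prop)
    · exact measurable_goodConfig.comp measurable_snd
    · exact Measurable.forall fun i => (measurableSet_setOfPred.1
        (measurableSet_eq_fun (by fun_prop) (by fun_prop))).not
  refine (Measure.ae_compProd_iff hm).2 ?_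
  have h1 : ∀ᵐ p ∂(stepLaw Λ), 0 < p.1 ∧ 0 < p.2 := by
    refine (ae_map_iff (by fun_prop) ?_).2 ?_
    · exact (measurableSet_lt measurable_const measurable_fst).inter
        (measurableSet_lt measurable_const measurable_snd)
    · filter_upwards [Measure.quasiMeasurePreserving_fst.ae ae_mem_unif,
        Measure.quasiMeasurePreserving_snd.ae (ae_pos_sizeBiased Λ h0)] with p h1 h2
      exact ⟨mul_pos h1.1 h2, mul_pos (by linarith [h1.2]) h2⟩
  filter_upwards [h1] with p hp
  rw [Kernel.comap_apply]
  have h2 : ∀ᵐ c ∂(poissonKernel (birthRate Λ) (p.1 + p.2)), ∀ i, (p.1 + p.2) * c.2 i ≠ p.1 := by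
    rw [poissonKernel_apply]
    refine Measure.quasiMeasurePreserving_snd.ae (p := fun f : ℕ → ℝ =>
      ∀ i, (p.1 + p.2) * f i ≠ p.1) (ae_all_iff.2 fun i => ?_)
    refine (measurePreserving_eval_infinitePi (fun _ : ℕ => unif) i).quasiMeasurePreserving.ae
      (p := fun x => (p.1 + p.2) * x ≠ p.1) ?_
    -- A grafting point meets the birth of the next spine individual only if its uniform fraction
    -- equals `A / (A + R)`.
    filter_upwards [measure_eq_zero_iff_ae_notMem.1
      (measure_singleton (μ := unif) (p.1 / (p.1 + p.2)))] with x hx hx'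
    exact hx (eq_div_of_mul_eq (by linarith) (by linarith))
  filter_upwards [ae_goodConfig (birthRate Λ) (p.1 + p.2), h2] with c h3 h4
  exact ⟨hp.1, hp.2, h3, h4⟩

lemma ae_goodLimit (h0 : Λ (Iic 0) = 0) (hm0 : meanOffspring Λ ≠ 0)
    (hm1 : meanOffspring Λ ≤ 1) : ∀ᵐ ξ ∂(limitLaw Λ), GoodLimit ξ := by
  have h1 : ∀ᵐ ξ ∂(limitLaw Λ), ∀ k, 0 < (ξ.1 k).1.1 ∧ 0 < (ξ.1 k).1.2 ∧
      GoodConfig (ξ.1 k).2 ∧ ∀ i, ((ξ.1 k).1.1 + (ξ.1 k).1.2) * (ξ.1 k).2.2 i ≠ (ξ.1 k).1.1 := by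
    rw [limitLaw_eq]
    refine Measure.quasiMeasurePreserving_fst.ae (p := fun s : ℕ → (ℝ × ℝ) × Config =>
      ∀ k, 0 < (s k).1.1 ∧ 0 < (s k).1.2 ∧ GoodConfig (s k).2 ∧
        ∀ i, ((s k).1.1 + (s k).1.2) * (s k).2.2 i ≠ (s k).1.1) (ae_all_iff.2 fun k => ?_)
    exact (measurePreserving_eval_infinitePi (fun _ : ℕ => stepConfigLaw Λ)
      k).quasiMeasurePreserving.ae (ae_stepConfigLaw Λ h0)
  have h2 : ∀ᵐ ξ ∂(limitLaw Λ), ∀ k i, GoodLives (ξ.2 k i) ∧ ∃ n, ¬ Reach n (ξ.2 k i) := by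
    rw [limitLaw_eq]
    refine Measure.quasiMeasurePreserving_snd.ae (p := fun e : ℕ → ℕ → Label → Life =>
      ∀ k i, GoodLives (e k i) ∧ ∃ n, ¬ Reach n (e k i)) (ae_all_iff.2 fun k => ?_)
    refine (measurePreserving_eval_infinitePi (fun _ : ℕ => Measure.infinitePi
      fun _ : ℕ => splittingLaw Λ) k).quasiMeasurePreserving.ae (p := fun e : ℕ → Label → Life =>
        ∀ i, GoodLives (e i) ∧ ∃ n, ¬ Reach n (e i)) (ae_all_iff.2 fun i => ?_)
    exact (measurePreserving_eval_infinitePi (fun _ : ℕ => splittingLaw Λ)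
      i).quasiMeasurePreserving.ae ((ae_goodLives Λ h0).and (ae_extinct Λ h0 hm0 hm1))
  filter_upwards [h1, h2] with ξ h1 h2
  exact ⟨fun k => (h1 k).1, fun k => (h1 k).2.1, fun k => (h1 k).2.2.1, fun k i => (h2 k i).1,
    fun k i => (h1 k).2.2.2 i, fun k i => (h2 k i).2⟩

lemma limitTreeLaw_eq (h0 : Λ (Iic 0) = 0) (hm0 : meanOffspring Λ ≠ 0)
    (hm1 : meanOffspring Λ ≤ 1) (σ : ℝ) {S : Set (Tree × Tree)} (hS : MeasurableSet S) :
    limitTreeLaw Λ (windowPair σ ⁻¹' S) =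
      ∫⁻ q, limitTreeLaw Λ (windowPair (σ - q.1.1.1) ⁻¹' stepEvent q σ S) ∂(stepDataLaw Λ) := by
  have hE : MeasurableSet {p : StepData × LimitData | windowPair σ
      (stepTree p.1 (limitTree p.2), stepSpine p.1 (limitSpine p.2)) ∈ S} :=
    hS.preimage ((measurable_windowPair σ).comp
      (((measurableTree_limitTree.comp measurable_snd).stepTree measurable_fst).measurable.prodMk
        ((measurableTree_limitSpine.comp measurable_snd).stepSpine measurable_fst).measurable))
  rw [limitTreeLaw, Measure.map_apply measurable_limitTree_limitSpine
    (hS.preimage (measurable_windowPair σ))]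
  have h1 : (fun ξ : LimitData => (limitTree ξ, limitSpine ξ)) ⁻¹' (windowPair σ ⁻¹' S)
      =ᵐ[limitLaw Λ] (fun ξ => (headData ξ, shiftData ξ)) ⁻¹' {p : StepData × LimitData |
        windowPair σ (stepTree p.1 (limitTree p.2), stepSpine p.1 (limitSpine p.2)) ∈ S} := by
    refine eventuallyEq_set.2 ?_
    filter_upwards [ae_goodLimit Λ h0 hm0 hm1] with ξ hξ
    simp only [mem_preimage, mem_ofPred_eq, windowPair]
    rw [← hξ.posPart_limitTree, ← hξ.posPart_limitSpine, window_posPart, window_posPart]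
  rw [measure_congr h1,
    (measurePreserving_head_shift Λ).measure_preimage hE.nullMeasurableSet, Measure.prod_apply hE]
  refine lintegral_congr fun q => ?_
  rw [Measure.map_apply measurable_limitTree_limitSpine
    ((measurableSet_stepEvent q σ hS).preimage (measurable_windowPair _))]
  congr 1
  ext ξ
  simp only [mem_preimage, windowPair_mem_stepEvent, mem_ofPred_eq]

/-! ### Contraction of the discrepancy on time windows -/

/-- The largest excess, over events of the window `(0, σ]`, of the probability for the conditioned
tree over the probability for the limiting tree. -/
noncomputable def excess (n : ℕ) (σ : ℝ) : ℝ≥0∞ :=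
  ⨆ (S : Set (Tree × Tree)) (_ : MeasurableSet S),
    (conditionedLaw Λ n (windowPair σ ⁻¹' S) - limitTreeLaw Λ (windowPair σ ⁻¹' S))

omit [IsProbabilityMeasure (sizeBiased Λ)] [IsFiniteMeasure Λ] [NeZero Λ] in
lemma le_add_excess (n : ℕ) (σ : ℝ) {S : Set (Tree × Tree)} (hS : MeasurableSet S) :
    conditionedLaw Λ n (windowPair σ ⁻¹' S) ≤
      limitTreeLaw Λ (windowPair σ ⁻¹' S) + excess Λ n σ := by
  rw [← tsub_le_iff_left]
  exact le_iSup₂_of_le S hS le_rfl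

omit [IsProbabilityMeasure (sizeBiased Λ)] [IsFiniteMeasure Λ] [NeZero Λ] in
lemma excess_mono (n : ℕ) {σ τ : ℝ} (h : σ ≤ τ) : excess Λ n σ ≤ excess Λ n τ := by
  refine iSup₂_le fun S hS => ?_
  have : windowPair σ ⁻¹' S = windowPair τ ⁻¹' (windowPair σ ⁻¹' S) := by
    ext X
    simp only [mem_preimage, windowPair, window_window h]
  rw [this]
  exact le_iSup₂_of_le _ (hS.preimage (measurable_windowPair σ)) le_rfl

/-- An empty window makes every event trivial, so both laws give it the same probability, 0 or 1.
This starts the induction in `tendsto_excess`. -/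
lemma excess_of_nonpos (h0 : Λ (Iic 0) = 0) (hm0 : meanOffspring Λ ≠ 0)
    (hm1 : meanOffspring Λ ≤ 1) (n : ℕ) {σ : ℝ} (h : σ ≤ 0) : excess Λ n σ = 0 := by
  have := isProbabilityMeasure_conditionedLaw Λ (survival_ne_zero Λ h0 hm0 hm1 n)
  have hw : ∀ T, window σ T = ∅ := fun T => by
    ext x
    simp only [window, mem_ofPred_eq, mem_empty_iff_false, iff_false]
    rintro ⟨_, h1, h2⟩
    linarith
  refine le_antisymm (iSup₂_le fun S _ => ?_) zero_le
  by_cases hS : (∅, ∅) ∈ S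
  · have : windowPair σ ⁻¹' S = univ := by ext X; simp [windowPair, hw, hS]
    simp [this]
  · have : windowPair σ ⁻¹' S = ∅ := by ext X; simp [windowPair, hw, hS]
    simp [this]

lemma excess_le_one (h0 : Λ (Iic 0) = 0) (hm0 : meanOffspring Λ ≠ 0)
    (hm1 : meanOffspring Λ ≤ 1) (n : ℕ) (σ : ℝ) : excess Λ n σ ≤ 1 := by
  have := isProbabilityMeasure_conditionedLaw Λ (survival_ne_zero Λ h0 hm0 hm1 n)
  exact iSup₂_le fun S _ => tsub_le_self.trans prob_le_one

/-- Both laws satisfy the same one-step recursion up to the conditioning on `NoRight n`, which costs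
the factor `(noRightProb Λ n)⁻¹`. When `A < ε` the remaining window is bounded by the full one;
otherwise it has length at most `σ - ε`. -/
lemma excess_succ_le (h0 : Λ (Iic 0) = 0) (hm0 : meanOffspring Λ ≠ 0)
    (hm1 : meanOffspring Λ ≤ 1) (n : ℕ) (σ ε : ℝ) :
    excess Λ (n + 1) σ ≤ ((noRightProb Λ n)⁻¹ - 1) + (noRightProb Λ n)⁻¹ *
      (stepDataLaw Λ {q | q.1.1.1 < ε} * excess Λ n σ + excess Λ n (σ - ε)) := by
  refine iSup₂_le fun S hS => ?_
  set c := (noRightProb Λ n)⁻¹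
  set b := limitTreeLaw Λ (windowPair σ ⁻¹' S) with hb
  have hA : MeasurableSet {q : StepData | q.1.1.1 < ε} :=
    measurableSet_lt (by fun_prop) measurable_const
  have hpos : ∀ᵐ q ∂(stepDataLaw Λ), 0 < q.1.1.1 :=
    Measure.quasiMeasurePreserving_fst.ae ((ae_stepConfigLaw Λ h0).mono fun q hq => hq.1)
  have hle : ∀ᵐ q ∂(stepDataLaw Λ),
      conditionedLaw Λ n (windowPair (σ - q.1.1.1) ⁻¹' stepEvent q σ S) ≤
      limitTreeLaw Λ (windowPair (σ - q.1.1.1) ⁻¹' stepEvent q σ S) +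
        ({q : StepData | q.1.1.1 < ε}.indicator (fun _ => excess Λ n σ) q +
          excess Λ n (σ - ε)) := by
    filter_upwards [hpos] with q hq
    refine (le_add_excess Λ n _ (measurableSet_stepEvent q σ hS)).trans ?_
    refine add_le_add_right ?_ _
    by_cases hqε : q.1.1.1 < ε
    · rw [indicator_of_mem (by exact hqε)]
      exact (excess_mono Λ n (by linarith)).trans le_self_add
    · rw [indicator_of_notMem (by exact hqε), zero_add]
      exact excess_mono Λ n (by linarith)
  have hmain : conditionedLaw Λ (n + 1) (windowPair σ ⁻¹' S) ≤
      c * (b + (stepDataLaw Λ {q | q.1.1.1 < ε} * excess Λ n σ + excess Λ n (σ - ε))) := by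
    rw [conditionedLaw_succ Λ h0 hm0 hm1 n σ hS]
    refine mul_le_mul_right ?_ _
    -- The restriction to `NoRight n` is dropped: only an upper bound is sought.
    refine (setLIntegral_le_lintegral _ _).trans ((lintegral_mono_ae hle).trans ?_)
    rw [lintegral_add_right _ (by exact (measurable_const.indicator hA).add measurable_const),
      lintegral_add_right _ measurable_const, lintegral_indicator_const hA, lintegral_const,
      measure_univ, mul_one, ← limitTreeLaw_eq Λ h0 hm0 hm1 σ hS, mul_comm (excess Λ n σ)]
  rw [tsub_le_iff_left]
  refine hmain.trans ?_
  rw [mul_add, ← add_assoc]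
  refine add_le_add_left ?_ _
  have hc : 1 ≤ c := ENNReal.one_le_inv.2 prob_le_one
  calc c * b = b + (c - 1) * b := by
        conv_lhs => rw [← add_tsub_cancel_of_le hc, add_mul, one_mul]
    _ ≤ b + (c - 1) := by
        exact add_le_add_right (mul_le_of_le_one_right' prob_le_one) _

/-- A bounded sequence which asymptotically contracts tends to zero. -/
lemma tendsto_zero_of_le_add_mul {x y q : ℕ → ℝ≥0∞} {ρ : ℝ≥0∞} (hx : ∀ n, x n ≤ 1)
    (hy : Tendsto y atTop (𝓝 0)) (hq : Tendsto q atTop (𝓝 ρ)) (hρ : ρ < 1)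
    (h : ∀ n, x (n + 1) ≤ y n + q n * x n) : Tendsto x atTop (𝓝 0) := by
  obtain ⟨ρ', h1, h2⟩ := exists_between hρ
  set L := limsup x atTop with hL
  have hL1 : L ≤ 1 := limsup_le_of_le (by isBoundedDefault) (Eventually.of_forall hx)
  have hLt : L ≠ ∞ := ne_top_of_le_ne_top ENNReal.one_ne_top hL1
  -- The limsup is finite and invariant under the index shift, so comparison with a rate `ρ' < 1`
  -- forces it to vanish.
  have h3 : L ≤ ρ' * L := by
    refine ENNReal.le_of_forall_pos_le_add fun δ hδ _ => ?_
    calc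
      L = limsup (fun n => x (n + 1)) atTop := (limsup_nat_add x 1).symm
      _ ≤ limsup (fun n => δ + ρ' * x n) atTop := by
        refine limsup_le_limsup ?_
        filter_upwards [hq.eventually_lt_const h1,
          hy.eventually_lt_const (ENNReal.coe_pos.2 hδ)] with n hn hn'
        exact (h n).trans (add_le_add hn'.le (mul_le_mul_left hn.le _))
      _ = δ + limsup (fun n => ρ' * x n) atTop :=
        limsup_const_add _ _ _ (by isBoundedDefault) (by isBoundedDefault)
      _ = ρ' * L + δ := by
        rw [ENNReal.limsup_const_mul_of_ne_top (h2.trans ENNReal.one_lt_top).ne, add_comm]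
  have h4 : L = 0 := by
    by_contra hne
    have : ρ' * L < 1 * L := ENNReal.mul_lt_mul_left hne hLt h2
    rw [one_mul] at this
    exact absurd h3 (not_le.2 this)
  exact tendsto_of_le_liminf_of_limsup_le zero_le h4.le

/-- Otherwise `A` would almost surely lie below every `1 / (n + 1)`, although it is almost surely
positive. -/
lemma exists_age_bound (h0 : Λ (Iic 0) = 0) :
    ∃ ε > 0, stepDataLaw Λ {q | q.1.1.1 < ε} < 1 := by
  have hA : ∀ n : ℕ, MeasurableSet {q : StepData | q.1.1.1 < 1 / ((n : ℝ) + 1)} := fun n =>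
    measurableSet_lt (by fun_prop) measurable_const
  have hpos : ∀ᵐ q ∂(stepDataLaw Λ), 0 < q.1.1.1 :=
    Measure.quasiMeasurePreserving_fst.ae ((ae_stepConfigLaw Λ h0).mono fun q hq => hq.1)
  by_contra hcon
  push Not at hcon
  have h1 : ∀ n : ℕ, ∀ᵐ q ∂(stepDataLaw Λ), q.1.1.1 < 1 / ((n : ℝ) + 1) := fun n =>
    (mem_ae_iff_prob_eq_one (hA n)).2 (le_antisymm prob_le_one (hcon _ (by positivity)))
  obtain ⟨q, hq, hq'⟩ := (hpos.and (ae_all_iff.2 h1)).exists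
  obtain ⟨n, hn⟩ := exists_nat_one_div_lt hq
  exact lt_asymm hn (hq' n)

/-- Induction over windows of length `k * ε`: the term for the window shorter by `ε` already tends
to zero, and the term for the same window is contracted by a factor tending to `P(A < ε) < 1`. -/
lemma tendsto_excess (h0 : Λ (Iic 0) = 0) (hm0 : meanOffspring Λ ≠ 0)
    (hm1 : meanOffspring Λ ≤ 1) (σ : ℝ) : Tendsto (fun n => excess Λ n σ) atTop (𝓝 0) := by
  obtain ⟨ε, hε, hρ⟩ := exists_age_bound Λ h0
  have hc : Tendsto (fun n => (noRightProb Λ n)⁻¹) atTop (𝓝 1) := by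
    simpa using (tendsto_noRightProb Λ h0 hm0 hm1).inv
  have key : ∀ k : ℕ, Tendsto (fun n => excess Λ n (k * ε)) atTop (𝓝 0) := by
    intro k
    induction k with
    | zero => simp [excess_of_nonpos Λ h0 hm0 hm1]
    | succ k ih =>
      refine tendsto_zero_of_le_add_mul (fun n => excess_le_one Λ h0 hm0 hm1 n _)
        (y := fun n => ((noRightProb Λ n)⁻¹ - 1) + (noRightProb Λ n)⁻¹ * excess Λ n (k * ε))
        (q := fun n => (noRightProb Λ n)⁻¹ * stepDataLaw Λ {q | q.1.1.1 < ε})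
        (ρ := 1 * stepDataLaw Λ {q | q.1.1.1 < ε}) ?_ ?_ (by rwa [one_mul]) fun n => ?_
      · have h1 : Tendsto (fun n => (noRightProb Λ n)⁻¹ - 1) atTop (𝓝 (1 - 1)) :=
          ENNReal.Tendsto.sub hc tendsto_const_nhds (Or.inl ENNReal.one_ne_top)
        have h2 : Tendsto (fun n => (noRightProb Λ n)⁻¹ * excess Λ n (k * ε)) atTop
            (𝓝 (1 * 0)) :=
          ENNReal.Tendsto.mul hc (Or.inl one_ne_zero) ih (Or.inr ENNReal.one_ne_top)
        simpa using h1.add h2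
      · exact ENNReal.Tendsto.mul_const hc (Or.inl one_ne_zero)
      · refine (excess_succ_le Λ h0 hm0 hm1 n _ ε).trans_eq ?_
        have : ((k + 1 : ℕ) : ℝ) * ε - ε = k * ε := by push_cast; ring
        rw [this]
        ring
  obtain ⟨k, hk⟩ := exists_nat_ge (σ / ε)
  refine tendsto_of_tendsto_of_tendsto_of_le_of_le tendsto_const_nhds (key k)
    (fun _ => zero_le) fun n => excess_mono Λ n ?_
  rwa [div_le_iff₀ hε] at hk

lemma tendsto_conditionedLaw (h0 : Λ (Iic 0) = 0) (hm0 : meanOffspring Λ ≠ 0)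
    (hm1 : meanOffspring Λ ≤ 1) (σ : ℝ) {S : Set (Tree × Tree)} (hS : MeasurableSet S) :
    Tendsto (fun n => conditionedLaw Λ n (windowPair σ ⁻¹' S)) atTop
      (𝓝 (limitTreeLaw Λ (windowPair σ ⁻¹' S))) := by
  have hex := tendsto_excess Λ h0 hm0 hm1 σ
  set b := limitTreeLaw Λ (windowPair σ ⁻¹' S) with hb
  have hbt : b ≠ ∞ := measure_ne_top _ _
  have hu : Tendsto (fun n => b + excess Λ n σ) atTop (𝓝 b) := by
    simpa using tendsto_const_nhds.add hex
  have hl : Tendsto (fun n => b - excess Λ n σ) atTop (𝓝 b) := by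
    simpa using ENNReal.Tendsto.sub tendsto_const_nhds hex (Or.inl hbt)
  refine tendsto_of_tendsto_of_tendsto_of_le_of_le hl hu (fun n => ?_)
    fun n => le_add_excess Λ n σ hS
  have := isProbabilityMeasure_conditionedLaw Λ (survival_ne_zero Λ h0 hm0 hm1 n)
  have hW := hS.preimage (measurable_windowPair σ)
  -- The excess is one-sided; for two probability measures the lower bound is the upper bound for
  -- the complementary event.
  have h1 := le_add_excess Λ n σ hS.compl
  rw [preimage_compl] at h1
  have h2 := prob_add_prob_compl (μ := conditionedLaw Λ n) hW
  have h3 := prob_add_prob_compl (μ := limitTreeLaw Λ) hW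
  rw [tsub_le_iff_right]
  refine (ENNReal.add_le_add_iff_right (measure_ne_top (limitTreeLaw Λ)
    (windowPair σ ⁻¹' S)ᶜ)).1 ?_
  calc b + limitTreeLaw Λ (windowPair σ ⁻¹' S)ᶜ
      = conditionedLaw Λ n (windowPair σ ⁻¹' S) + conditionedLaw Λ n (windowPair σ ⁻¹' S)ᶜ := by
        rw [h2, h3]
    _ ≤ conditionedLaw Λ n (windowPair σ ⁻¹' S) +
        (limitTreeLaw Λ (windowPair σ ⁻¹' S)ᶜ + excess Λ n σ) := add_le_add_right h1 _
    _ = _ := by rw [add_assoc, add_comm (excess Λ n σ)]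

end Laws

/-! ### The infinite branch of the limiting tree -/

lemma getElem?_wordPrefix {v : ℕ → ℕ+} {n j : ℕ} (h : j < n) :
    (wordPrefix v n)[j]? = some (v j) := by
  simp [wordPrefix, h]

lemma length_wordPrefix (v : ℕ → ℕ+) (n : ℕ) : (wordPrefix v n).length = n := by
  simp [wordPrefix]

/-- The labels, among their sisters, of the individuals of the spine. -/
noncomputable def spineWord (ξ : LimitData) (k : ℕ) : ℕ+ :=
  daughterLabel (spineBirthAges ξ k) (spineSteps ξ k).1

lemma wordPrefix_spineWord (ξ : LimitData) (n : ℕ) :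
    wordPrefix (spineWord ξ) n = spineLabel ξ n := by
  induction n with
  | zero => rfl
  | succ n ih =>
    rw [spineLabel, ← ih, wordPrefix, List.range_succ, List.map_append]
    rfl

lemma length_spineLabel (ξ : LimitData) (n : ℕ) : (spineLabel ξ n).length = n := by
  rw [← wordPrefix_spineWord, length_wordPrefix]

namespace GoodLimit

variable {ξ : LimitData} (h : GoodLimit ξ)
include h

lemma graftLabel_ne {k i : ℕ} (hi : i < (ξ.1 k).2.1) :
    daughterLabel (spineBirthAges ξ k) (graftAge ξ k i) ≠ spineWord ξ k := fun heq =>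
  h.graftAge_ne k i (daughterLabel_injOn (Finset.mem_insert_of_mem
    (Finset.mem_image_of_mem _ (Finset.mem_range.2 hi))) (Finset.mem_insert_self _ _) heq)

lemma isInfiniteBranch_spineWord : IsInfiniteBranch (limitTree ξ) (spineWord ξ) := by
  intro n
  rw [wordPrefix_spineWord]
  refine ⟨(spineLabel ξ n, spineBirth (spineSteps ξ) n + (spineSteps ξ n).1 +
    (spineSteps ξ n).2), mem_limitTree.2 (Or.inl ⟨n, rfl, Or.inr ⟨?_, le_rfl⟩⟩), rfl⟩
  have h1 := h.age_pos n
  have h2 := h.residual_pos n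
  change _ < spineBirth (spineSteps ξ) n + (spineSteps ξ n).1 + (spineSteps ξ n).2
  linarith

/-- Let `k` be the generation where the branch leaves the spine. Its longer prefixes then lie in
trees grafted on the `k`-th spine individual, so for each `n` one of these reaches generation `n`,
against the extinction of finitely many trees. -/
lemma eq_spineWord {w : ℕ → ℕ+} (hw : IsInfiniteBranch (limitTree ξ) w) : w = spineWord ξ := by
  classical
  by_contra hne
  have hex : ∃ k, w k ≠ spineWord ξ k := Function.ne_iff.1 hne
  set k := Nat.find hex
  have hk : w k ≠ spineWord ξ k := Nat.find_spec hex
  have hlt : ∀ j < k, w j = spineWord ξ j := fun j hj => not_not.1 (Nat.find_min hex hj)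
  have key : ∀ n, ∃ i < (ξ.1 k).2.1, Reach n (ξ.2 k i) := by
    intro n
    obtain ⟨⟨u, s⟩, hu, hus⟩ := hw (k + 1 + n)
    obtain rfl : u = _ := hus
    rcases mem_limitTree.1 hu with ⟨k', hk', _⟩ | ⟨k', i, hi, u, τ, hu', _, hx⟩
    · have hk'' : wordPrefix w (k + 1 + n) = spineLabel ξ k' := hk'
      have hlen := congrArg List.length hk''
      rw [length_wordPrefix, length_spineLabel] at hlen
      have hget : (wordPrefix w (k + 1 + n))[k]? = (spineLabel ξ k')[k]? := by rw [hk'']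
      rw [getElem?_wordPrefix (by omega), ← wordPrefix_spineWord,
        getElem?_wordPrefix (by omega)] at hget
      exact absurd (Option.some.inj hget) hk
    · have hpre : wordPrefix w (k + 1 + n) = spineLabel ξ k' ++
          [daughterLabel (spineBirthAges ξ k') (graftAge ξ k' i)] ++ u := (Prod.ext_iff.1 hx).1
      have hlen := congrArg List.length hpre
      simp only [length_wordPrefix, List.length_append, length_spineLabel, List.length_singleton]
        at hlen
      have hget := fun j : ℕ => congrArg (fun l : Label => l[j]?) hpre
      simp only [List.append_assoc] at hget
      -- A graft on individual `k'` agrees with the spine exactly up to generation `k'`, so `k' < k`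
      -- would make the branch leave too early and `k' > k` too late.
      rcases lt_trichotomy k' k with hlt' | heq | hgt
      · have := hget k'
        rw [getElem?_wordPrefix (by omega), List.getElem?_append_right
          (by rw [length_spineLabel]), length_spineLabel] at this
        simp only [Nat.sub_self, List.cons_append, List.getElem?_cons_zero, Option.some.injEq]
          at this
        exact absurd (this.symm.trans (hlt k' hlt')) (h.graftLabel_ne hi)
      · rw [← heq]
        refine ⟨i, hi, (exists_individual_iff_reach (h.lives k' i)).1 ⟨u, ⟨(u, τ), hu', rfl⟩, ?_⟩⟩
        omega
      · have := hget k
        rw [getElem?_wordPrefix (by omega), List.getElem?_append_left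
          (by rw [length_spineLabel]; exact hgt), ← wordPrefix_spineWord,
          getElem?_wordPrefix hgt] at this
        exact absurd (Option.some.inj this) hk
  choose N hN using h.extinct k
  obtain ⟨i, hi, hr⟩ := key ((Finset.range (ξ.1 k).2.1).sup N)
  exact hN i (Reach.anti (Finset.le_sup (Finset.mem_range.2 hi)) hr)

/-- A point of a graft on individual `k` carries at position `k` the label of a sister of the next
spine individual, so its word is no prefix of the spine. -/
lemma limitSpine_eq : limitSpine ξ =
    {x ∈ limitTree ξ | ∃ n, x.1 = wordPrefix (spineWord ξ) n} := by
  ext x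
  constructor
  · rintro ⟨k, hk, hx⟩
    exact ⟨mem_limitTree.2 (Or.inl ⟨k, hk, hx⟩), k, by rw [hk, wordPrefix_spineWord]⟩
  · rintro ⟨hx, n, hn⟩
    rcases mem_limitTree.1 hx with hx | ⟨k, i, hi, u, τ, _, _, hx⟩
    · exact hx
    · have hpre : wordPrefix (spineWord ξ) n = spineLabel ξ k ++
          [daughterLabel (spineBirthAges ξ k) (graftAge ξ k i)] ++ u :=
        hn.symm.trans (Prod.ext_iff.1 hx).1
      have hlen := congrArg List.length hpre
      simp only [length_wordPrefix, List.length_append, length_spineLabel, List.length_singleton]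
        at hlen
      have hget := congrArg (fun l : Label => l[k]?) hpre
      simp only [List.append_assoc] at hget
      rw [getElem?_wordPrefix (by omega), List.getElem?_append_right
        (by rw [length_spineLabel]), length_spineLabel] at hget
      simp only [Nat.sub_self, List.cons_append, List.getElem?_cons_zero, Option.some.injEq]
        at hget
      exact absurd hget.symm (h.graftLabel_ne hi)

end GoodLimit

/-! ### Finite truncations -/

section Laws

variable (Λ : Measure ℝ) [IsFiniteMeasure Λ] [NeZero Λ]

/-- The conditioning events agree up to a null set, which changes neither the normalization nor the
restricted measure. -/
lemma condLaw_eq (h0 : Λ (Iic 0) = 0) (n : ℕ) :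
    condLaw Λ n = (splittingLaw Λ)[|{d | Reach n d}] := by
  have h : {d | genSize n (tree d) ≠ 0} =ᵐ[splittingLaw Λ] {d | Reach n d} :=
    eventuallyEq_set.2 (by
      filter_upwards [ae_goodLives Λ h0] with d hd using genSize_ne_zero_iff hd)
  rw [condLaw, ProbabilityTheory.cond, ProbabilityTheory.cond, measure_congr h,
    Measure.restrict_congr_set h]

/-- Adding the root to two sets of points. -/
def insertRoot (X : Tree × Tree) : Tree × Tree := (insert ([], 0) X.1, insert ([], 0) X.2)

lemma measurable_insertRoot : Measurable insertRoot :=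
  (measurable_set_iff.2 fun x => measurable_const.or
    ((measurable_set_mem x).comp measurable_fst)).prodMk
  (measurable_set_iff.2 fun x => measurable_const.or
    ((measurable_set_mem x).comp measurable_snd))

lemma condLaw_trunc (h0 : Λ (Iic 0) = 0) (n : ℕ) {σ : ℝ} (hσ : 0 < σ) {S : Set (Tree × Tree)}
    (hS : MeasurableSet S) :
    condLaw Λ n {d | (trunc σ (tree d), trunc σ (firstLineage n (tree d))) ∈ S} =
      conditionedLaw Λ n (windowPair σ ⁻¹' (insertRoot ⁻¹' S)) := by
  rw [condLaw_eq Λ h0, conditionedLaw, Measure.map_apply (measurable_tree_lineage n)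
    ((hS.preimage measurable_insertRoot).preimage (measurable_windowPair σ))]
  refine measure_congr (eventuallyEq_set.2 ?_)
  filter_upwards [cond_absolutelyContinuous.ae_le (ae_goodLives Λ h0),
    ae_cond_mem (measurableSet_reach n)] with d hd hr
  simp only [mem_preimage, insertRoot, windowPair]
  rw [trunc_tree hd hσ, trunc_firstLineage hd hr hσ]

variable [IsProbabilityMeasure (sizeBiased Λ)]

lemma limitLaw_trunc (h0 : Λ (Iic 0) = 0) (hm0 : meanOffspring Λ ≠ 0)
    (hm1 : meanOffspring Λ ≤ 1) {σ : ℝ} (hσ : 0 < σ) {S : Set (Tree × Tree)}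
    (hS : MeasurableSet S) :
    limitLaw Λ {ξ | (trunc σ (limitTree ξ), trunc σ (limitSpine ξ)) ∈ S} =
      limitTreeLaw Λ (windowPair σ ⁻¹' (insertRoot ⁻¹' S)) := by
  rw [limitTreeLaw, Measure.map_apply measurable_limitTree_limitSpine
    ((hS.preimage measurable_insertRoot).preimage (measurable_windowPair σ))]
  refine measure_congr (eventuallyEq_set.2 ?_)
  filter_upwards [ae_goodLimit Λ h0 hm0 hm1] with ξ hξ
  simp only [mem_preimage, insertRoot, windowPair]
  rw [hξ.trunc_limitTree hσ, hξ.trunc_limitSpine hσ]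

lemma tendsto_condLaw_trunc (h0 : Λ (Iic 0) = 0) (hm0 : meanOffspring Λ ≠ 0)
    (hm1 : meanOffspring Λ ≤ 1) {σ : ℝ} (hσ : 0 < σ) {S : Set (Tree × Tree)}
    (hS : MeasurableSet S) :
    Tendsto (fun n => condLaw Λ n
      {d | (trunc σ (tree d), trunc σ (firstLineage n (tree d))) ∈ S}) atTop
      (𝓝 (limitLaw Λ {ξ | (trunc σ (limitTree ξ), trunc σ (limitSpine ξ)) ∈ S})) := by
  simp only [condLaw_trunc Λ h0 _ hσ hS]
  rw [limitLaw_trunc Λ h0 hm0 hm1 hσ hS]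
  exact tendsto_conditionedLaw Λ h0 hm0 hm1 σ (hS.preimage measurable_insertRoot)

/-! ### The spine modulo labelling -/

lemma measurePreserving_spineSteps : MeasurePreserving spineSteps (limitLaw Λ)
    (Measure.infinitePi fun _ : ℕ => stepLaw Λ) := by
  have h1 : MeasurePreserving (fun (s : ℕ → (ℝ × ℝ) × Config) k => (s k).1)
      (Measure.infinitePi fun _ : ℕ => stepConfigLaw Λ)
      (Measure.infinitePi fun _ : ℕ => stepLaw Λ) := by
    refine ⟨by fun_prop, ?_⟩
    rw [Measure.infinitePi_map_pi (fun _ : ℕ => stepConfigLaw Λ)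
      (f := fun _ : ℕ => (Prod.fst : (ℝ × ℝ) × Config → ℝ × ℝ)) fun _ => measurable_fst]
    congr 1
    funext _
    exact Measure.fst_compProd _ _
  exact h1.comp measurePreserving_fst

end Laws

lemma measurable_unlabelledSpine : Measurable unlabelledSpine := by
  have hb : ∀ k, Measurable fun AR : ℕ → ℝ × ℝ => spineBirth AR k := fun k =>
    Finset.measurable_fun_sum _ fun i _ => (measurable_pi_apply i).fst
  refine measurable_set_iff.2 fun x => measurable_const.or (Measurable.and ?_ ?_)
  · exact measurable_lt_prop (hb _) measurable_const
  · exact measurable_le_prop measurable_const (((hb _).add (by fun_prop)).add (by fun_prop))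

lemma measurable_trunc {α : Type} (σ : ℝ) : Measurable (trunc (α := α) σ) :=
  measurable_set_iff.2 fun x => (measurable_set_mem x).and measurable_const

lemma measurable_forgetLabels : Measurable forgetLabels := by
  refine measurable_set_iff.2 fun x => ?_
  have : (fun T : Tree => x ∈ forgetLabels T) =
      fun T => ∃ u : Label, u.length = x.1 ∧ (u, x.2) ∈ T := by
    funext T
    refine propext ⟨?_, ?_⟩
    · rintro ⟨y, hy, rfl⟩; exact ⟨y.1, rfl, hy⟩
    · rintro ⟨u, hu, hT⟩; exact ⟨(u, x.2), hT, Prod.ext hu rfl⟩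
  rw [this]
  exact Measurable.exists fun u => measurable_const.and (measurable_set_mem _)

lemma trunc_forgetLabels (σ : ℝ) (T : Tree) :
    trunc σ (forgetLabels T) = forgetLabels (trunc σ T) := by
  ext x
  constructor
  · rintro ⟨⟨y, hy, rfl⟩, hx⟩; exact ⟨y, ⟨hy, hx⟩, rfl⟩
  · rintro ⟨y, ⟨hy, hx⟩, rfl⟩; exact ⟨⟨y, hy, rfl⟩, hx⟩

lemma forgetLabels_limitSpine (ξ : LimitData) :
    forgetLabels (limitSpine ξ) = unlabelledSpine (spineSteps ξ) := by
  ext x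
  constructor
  · rintro ⟨y, ⟨k, hk, hy⟩, rfl⟩
    change SpineAlive _ y.1.length y.2
    rwa [hk, length_spineLabel]
  · intro hx
    exact ⟨(spineLabel ξ x.1, x.2), ⟨x.1, rfl, hx⟩, Prod.ext (length_spineLabel ξ x.1) rfl⟩

lemma meanOffspring_ne_zero {Λ : Measure ℝ} (h0 : Λ (Iic 0) = 0) (hΛ : Λ ≠ 0) :
    meanOffspring Λ ≠ 0 := by
  intro h
  rw [meanOffspring, lintegral_eq_zero_iff ENNReal.measurable_ofReal] at h
  have h1 : ∀ᵐ z ∂Λ, z ≤ 0 := by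
    filter_upwards [h] with z hz using ENNReal.ofReal_eq_zero.1 hz
  have h2 : ∀ᵐ z ∂Λ, 0 < z := by simp only [ae_iff, not_lt]; exact h0
  have h3 : ∀ᵐ _ ∂Λ, False := by
    filter_upwards [h1, h2] with z hz hz' using absurd hz (not_le.2 hz')
  exact hΛ (ae_eq_bot.1 (eventually_false_iff_eq_bot.1 h3))

end SplittingTree

theorem theorem2 (Λ : Measure ℝ) [IsFiniteMeasure Λ] (hΛ_pos : Λ (Iic 0) = 0) (hΛ_ne : Λ ≠ 0)
    (hm : (SplittingTree.meanOffspring Λ < 1 ∧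
        ∫⁻ z in Ici 1, ENNReal.ofReal (z * Real.log z) ∂Λ < ∞) ∨
      (SplittingTree.meanOffspring Λ = 1 ∧ ∫⁻ z, ENNReal.ofReal (z ^ 2) ∂Λ < ∞)) :
    -- the first lineage converges, modulo labelling, to the spine given by an i.i.d. sequence
    (∀ σ : ℝ, 0 < σ → ∀ S : Set (Set (ℕ × ℝ)), MeasurableSet S →
      Tendsto
        (fun n => SplittingTree.condLaw Λ n
          {d | SplittingTree.trunc σ (SplittingTree.forgetLabels
            (SplittingTree.firstLineage n (SplittingTree.tree d))) ∈ S})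
        atTop
        (𝓝 (Measure.infinitePi (fun _ : ℕ => SplittingTree.stepLaw Λ)
          {AR | SplittingTree.trunc σ (SplittingTree.unlabelledSpine AR) ∈ S}))) ∧
    -- the tree, jointly with its first lineage, converges to the limiting tree with its spine
    (∀ σ : ℝ, 0 < σ → ∀ S : Set (SplittingTree.Tree × SplittingTree.Tree), MeasurableSet S →
      Tendsto
        (fun n => SplittingTree.condLaw Λ n
          {d | (SplittingTree.trunc σ (SplittingTree.tree d),
            SplittingTree.trunc σ (SplittingTree.firstLineage n (SplittingTree.tree d))) ∈ S})
        atTop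
        (𝓝 (SplittingTree.limitLaw Λ
          {ξ | (SplittingTree.trunc σ (SplittingTree.limitTree ξ),
            SplittingTree.trunc σ (SplittingTree.limitSpine ξ)) ∈ S}))) ∧
    -- almost surely, the limiting tree has a unique infinite branch, which is its spine
    (∀ᵐ ξ ∂(SplittingTree.limitLaw Λ), ∃ v : ℕ → ℕ+,
      (∀ w : ℕ → ℕ+, SplittingTree.IsInfiniteBranch (SplittingTree.limitTree ξ) w ↔ w = v) ∧
      SplittingTree.limitSpine ξ =
        {x ∈ SplittingTree.limitTree ξ | ∃ n, x.1 = SplittingTree.wordPrefix v n}) := by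
  have : NeZero Λ := ⟨hΛ_ne⟩
  have hm0 : SplittingTree.meanOffspring Λ ≠ 0 :=
    SplittingTree.meanOffspring_ne_zero hΛ_pos hΛ_ne
  have hm1 : SplittingTree.meanOffspring Λ ≤ 1 := by
    rcases hm with h | h
    · exact h.1.le
    · exact h.1.le
  have := SplittingTree.isProbabilityMeasure_sizeBiased Λ hm0
    (ne_top_of_le_ne_top ENNReal.one_ne_top hm1)
  refine ⟨fun σ hσ S hS => ?_,
    fun σ hσ S hS => SplittingTree.tendsto_condLaw_trunc Λ hΛ_pos hm0 hm1 hσ hS, ?_⟩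
  -- Part 1 is the joint convergence for events on the second component alone: forgetting labels
  -- commutes with truncation, and the unlabelled limiting spine depends only on the i.i.d. pairs
  -- `(A_k, R_k)`.
  · have h := SplittingTree.tendsto_condLaw_trunc Λ hΛ_pos hm0 hm1 hσ
      (hS.preimage (SplittingTree.measurable_forgetLabels.comp measurable_snd))
    have h' := (SplittingTree.measurePreserving_spineSteps Λ).measure_preimage
      (s := {AR | SplittingTree.trunc σ (SplittingTree.unlabelledSpine AR) ∈ S})
      (hS.preimage ((SplittingTree.measurable_trunc σ).comp
        SplittingTree.measurable_unlabelledSpine)).nullMeasurableSet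
    rw [← h']
    simp only [mem_preimage, Function.comp_apply, ← SplittingTree.trunc_forgetLabels,
      SplittingTree.forgetLabels_limitSpine] at h
    exact h
  · filter_upwards [SplittingTree.ae_goodLimit Λ hΛ_pos hm0 hm1] with ξ hξ
    exact ⟨SplittingTree.spineWord ξ, fun w => ⟨hξ.eq_spineWord, fun h =>
      h ▸ hξ.isInfiniteBranch_spineWord⟩, hξ.limitSpine_eq⟩
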